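/- A metrized graph $\Gamma$ is a finite connected graph (multiple edges and self-loops allowed) in which each edge $e$ is identified with a segment $[0,L_e]$, $L_e>0$; $dx$ denotes arc length on $\Gamma$. For $y,z\in\Gamma$ let $x\mapsto j_z(x,y)$ be the continuous piecewise affine function on $\Gamma$ with $\Delta_x j_z(x,y)=\delta_y-\delta_z$ and $j_z(z,y)=0$, where the Laplacian of a continuous piecewise affine function $f$ is $\Delta f=-\sum_{x}\big(\sum_{\vec v\text{ at }x} d_{\vec v}f(x)\big)\delta_x$, the inner sum being over the directions emanating from $x$. Let $r(x,y)=j_x(y,y)$ be the effective resistance. Let $\mu_{can}$ be the signed Borel measure on $\Gamma$ of total mass $1$ for which $\int_\Gamma j_\zeta(x,x)\,d\mu_{can}(\zeta)$ is independent of $x\in\Gamma$, and let the tau constant $\tau(\Gamma)$ be one half of this constant value. For $p,q\in\Gamma$ put $$A_{p,q,\Gamma}=\int_\Gamma j_x(p,q)\Big(\frac{d}{dx}j_p(x,q)\Big)^2dx .$$ Let $\Gamma$ be a metrized graph. (1) Let $e_i$ be an edge of $\Gamma$ of length $L_i$ with end points $p_i,q_i$, such that the graph $\Gamma-e_i$ obtained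 by deleting the interior of $e_i$ is connected. Let $R_i$ be the effective resistance between $p_i$ and $q_i$ in $\Gamma-e_i$, let $\overline\Gamma_i$ be the graph obtained from $\Gamma$ by contracting $e_i$, and let $\widetilde\Gamma_i$ be the graph obtained from $\Gamma$ by identifying $p_i$ with $q_i$ (so that $e_i$ becomes a self-loop). Then $$\tau(\Gamma)=\tau(\overline\Gamma_i)+\frac{L_i}{12}-\frac{L_i\,A_{p_i,q_i,\Gamma-e_i}}{R_i(L_i+R_i)},\qquad \tau(\Gamma)=\tau(\widetilde\Gamma_i)-\frac{L_i\,A_{p_i,q_i,\Gamma-e_i}}{R_i(L_i+R_i)},$$ where, if $e_i$ is a self-loop (in which case $A_{p_i,q_i,\Gamma-e_i}=R_i=0$), the fraction with denominator $R_i(L_i+R_i)$ is read as $0$. (2) Let $p\ne q$ be two distinct points of $\Gamma$ (vertices or not), and let $\Gamma_{pq}$ be the metrized graph obtained by identifying $p$ with $q$. Then $$\tau(\Gamma_{pq})=\tau(\Gamma)-\frac{r(p,q)}{6}+\frac{A_{p,q,\Gamma}}{r(p,q)}.$$ -/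

import Mathlib

open MeasureTheory Set Filter Topology

universe u v

/-- A finite graph, possibly with multiple edges and self-loops, in which every edge `e` is
parametrized by the segment `[0, len e]`, going from the vertex `src e` to the vertex `tgt e`.
Connectedness, which is part of the notion of a metrized graph, is the separate predicate
`MetrizedGraph.Connected`. -/
structure MetrizedGraph where
  V : Type u
  E : Type v
  finite_V : Finite V
  finite_E : Finite E
  src : E → V
  tgt : E → V
  len : E → ℝ
  len_pos : ∀ e, 0 < len e

namespace MetrizedGraph

noncomputable section

open scoped Classical in
instance instFintypeE (Γ : MetrizedGraph.{u, v}) : Fintype Γ.E :=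
  haveI := Γ.finite_E
  Fintype.ofFinite Γ.E

/-- The graph is non-empty and any two vertices are joined by a chain of edges. -/
def Connected (Γ : MetrizedGraph.{u, v}) : Prop :=
  Nonempty Γ.V ∧
    ∀ a b : Γ.V, Relation.EqvGen (fun x y => ∃ e, Γ.src e = x ∧ Γ.tgt e = y) a b

/-! ### The points of a metrized graph -/

/-- The points of the metrized graph: its vertices, and the interior points of its edges. -/
inductive Point (Γ : MetrizedGraph.{u, v}) : Type (max u v)
  | vertex (a : Γ.V) : Point Γ
  | inner (e : Γ.E) (t : Ioo (0 : ℝ) (Γ.len e)) : Point Γ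

open scoped Classical in
/-- The parametrization of the edge `e` by `[0, len e]`, extended to the real line by the constant
values `src e` on the left of `0` and `tgt e` on the right of `len e`. -/
def path (Γ : MetrizedGraph.{u, v}) (e : Γ.E) (t : ℝ) : Γ.Point :=
  if h : t ∈ Ioo (0 : ℝ) (Γ.len e) then Point.inner e ⟨t, h⟩
  else if t ≤ 0 then Point.vertex (Γ.src e) else Point.vertex (Γ.tgt e)

/-- The topology of the graph obtained by gluing the segments `[0, len e]` at the vertices: a set
is open if and only if its preimage under the parametrization of each edge is open. -/
instance instTopologicalSpacePoint (Γ : MetrizedGraph.{u, v}) : TopologicalSpace Γ.Point :=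
  ⨆ e : Γ.E, TopologicalSpace.coinduced (Γ.path e) inferInstance

instance instMeasurableSpacePoint (Γ : MetrizedGraph.{u, v}) : MeasurableSpace Γ.Point :=
  borel Γ.Point

instance instBorelSpacePoint (Γ : MetrizedGraph.{u, v}) : BorelSpace Γ.Point := ⟨rfl⟩

/-- The integral over the graph, with respect to arc length, of a function given on the edges:
`h e t` is the value of the integrand at the point of the edge `e` with parameter `t`. -/
def edgeIntegral (Γ : MetrizedGraph.{u, v}) (h : Γ.E → ℝ → ℝ) : ℝ :=
  ∑ e : Γ.E, ∫ t in (0 : ℝ)..(Γ.len e), h e t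

/-! ### Piecewise affine functions, the Laplacian and the voltage function -/

/-- Continuous functions that are affine on a neighbourhood of every point in the interior of an
edge, with finitely many exceptions. -/
def IsPiecewiseAffine (Γ : MetrizedGraph.{u, v}) (f : Γ.Point → ℝ) : Prop :=
  Continuous f ∧ ∃ S : Set Γ.Point, S.Finite ∧
    ∀ (e : Γ.E), ∀ t ∈ Ioo (0 : ℝ) (Γ.len e), Γ.path e t ∉ S →
      ∃ a b : ℝ, ∀ᶠ s in 𝓝 t, f (Γ.path e s) = a + b * s

open scoped Classical in
/-- The sum of the directional derivatives of `f` in all directions emanating from a point. -/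
def slopeSum (Γ : MetrizedGraph.{u, v}) (f : Γ.Point → ℝ) : Γ.Point → ℝ
  | .vertex a =>
      (∑ e : Γ.E, if Γ.src e = a then
        derivWithin (fun s => f (Γ.path e s)) (Ici 0) 0 else 0) +
      ∑ e : Γ.E, if Γ.tgt e = a then
        -derivWithin (fun s => f (Γ.path e s)) (Iic (Γ.len e)) (Γ.len e) else 0
  | .inner e t =>
      derivWithin (fun s => f (Γ.path e s)) (Ici (t : ℝ)) t +
        -derivWithin (fun s => f (Γ.path e s)) (Iic (t : ℝ)) t

/-- The mass that the Laplacian of a continuous piecewise affine function puts on a point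
(the Laplacian of such a function is a discrete measure). -/
def laplacianMass (Γ : MetrizedGraph.{u, v}) (f : Γ.Point → ℝ) (x : Γ.Point) : ℝ :=
  -Γ.slopeSum f x

open scoped Classical in
/-- `f` is continuous and piecewise affine, its Laplacian is `δ_y - δ_z`, and `f z = 0`. -/
def IsVoltage (Γ : MetrizedGraph.{u, v}) (z y : Γ.Point) (f : Γ.Point → ℝ) : Prop :=
  Γ.IsPiecewiseAffine f ∧
    (∀ x, Γ.laplacianMass f x = (if x = y then 1 else 0) - (if x = z then 1 else 0)) ∧
    f z = 0

open scoped Classical in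
/-- The voltage function: `Γ.voltage z x y` is `j_z(x, y)`. On a connected graph, `x ↦ j_z(x, y)`
is the unique function `f` with `Γ.IsVoltage z y f`. -/
def voltage (Γ : MetrizedGraph.{u, v}) (z x y : Γ.Point) : ℝ :=
  if h : ∃ f : Γ.Point → ℝ, Γ.IsVoltage z y f then h.choose x else 0

/-- The effective resistance `r(x, y) = j_x(y, y)`. -/
def resistance (Γ : MetrizedGraph.{u, v}) (x y : Γ.Point) : ℝ :=
  Γ.voltage x y y

/-- `A_{p,q,Γ}`, the integral over `Γ` of `j_x(p, q) (d/dx j_p(x, q))²`. -/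
def A (Γ : MetrizedGraph.{u, v}) (p q : Γ.Point) : ℝ :=
  Γ.edgeIntegral fun e t =>
    Γ.voltage (Γ.path e t) p q * (deriv (fun s => Γ.voltage p (Γ.path e s) q) t) ^ 2

/-! ### The canonical measure and the tau constant -/

/-- `j_μ(x, y)`, the integral of `ζ ↦ j_ζ(x, y)` with respect to the signed measure `μ`. -/
def voltageOf (Γ : MetrizedGraph.{u, v}) (μ : SignedMeasure Γ.Point) (x y : Γ.Point) : ℝ :=
  ∫ᵛ ζ, Γ.voltage ζ x y ∂<•μ

/-- `μ` has total mass `1`, and `j_μ(x, x)` is constant, equal to `c`. -/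
def IsCanonicalMeasureWith (Γ : MetrizedGraph.{u, v}) (μ : SignedMeasure Γ.Point) (c : ℝ) : Prop :=
  μ univ = 1 ∧ ∀ x, Γ.voltageOf μ x x = c

open scoped Classical in
/-- The tau constant: one half of the constant value of `j_μ(x, x)`, where `μ` is the canonical
measure, that is, the signed Borel measure of total mass `1` for which `j_μ(x, x)` is constant. -/
def tau (Γ : MetrizedGraph.{u, v}) : ℝ :=
  if h : ∃ c : ℝ, ∃ μ : SignedMeasure Γ.Point, Γ.IsCanonicalMeasureWith μ c
    then (1 / 2) * h.choose else 0

/-! ### Deletion and contraction of an edge, identification of vertices -/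

/-- `Γ - e`: the graph obtained by deleting the interior of the edge `e`. -/
def deleteEdge (Γ : MetrizedGraph.{u, v}) (e : Γ.E) : MetrizedGraph.{u, v} where
  V := Γ.V
  E := {f : Γ.E // f ≠ e}
  finite_V := Γ.finite_V
  finite_E := haveI := Γ.finite_E; inferInstance
  src f := Γ.src f.1
  tgt f := Γ.tgt f.1
  len f := Γ.len f.1
  len_pos f := Γ.len_pos f.1

/-- The graph obtained by identifying the vertices `a` and `b`; all edges are kept. -/
def identifyVertices (Γ : MetrizedGraph.{u, v}) (a b : Γ.V) : MetrizedGraph.{u, v} where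
  V := Quot fun x y : Γ.V => x = a ∧ y = b
  E := Γ.E
  finite_V := haveI := Γ.finite_V; inferInstance
  finite_E := Γ.finite_E
  src e := Quot.mk _ (Γ.src e)
  tgt e := Quot.mk _ (Γ.tgt e)
  len := Γ.len
  len_pos := Γ.len_pos

/-- The graph obtained from `Γ` by identifying the end points of the edge `e`, which becomes a
self-loop. -/
def identifyEnds (Γ : MetrizedGraph.{u, v}) (e : Γ.E) : MetrizedGraph.{u, v} :=
  Γ.identifyVertices (Γ.src e) (Γ.tgt e)

/-- The graph obtained from `Γ` by contracting the edge `e`: its end points are identified, and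
the edge itself disappears. -/
def contractEdge (Γ : MetrizedGraph.{u, v}) (e : Γ.E) : MetrizedGraph.{u, v} :=
  (Γ.identifyEnds e).deleteEdge e

/-! ### Identification of two arbitrary points -/

open scoped Classical in
/-- The same metrized graph, where the point of the edge `e` with parameter `t` is made a vertex.
The new vertex is `none`; the edge `some e` is the part `[0, t]` of `e`, and the edge `none` is
the part `[t, len e]`. -/
def splitEdge (Γ : MetrizedGraph.{u, v}) (e : Γ.E) (t : Ioo (0 : ℝ) (Γ.len e)) :
    MetrizedGraph.{u, v} where
  V := Option Γ.V
  E := Option Γ.E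
  finite_V := haveI := Γ.finite_V; inferInstance
  finite_E := haveI := Γ.finite_E; inferInstance
  src
    | some f => some (Γ.src f)
    | none => none
  tgt
    | some f => if f = e then none else some (Γ.tgt f)
    | none => some (Γ.tgt e)
  len
    | some f => if f = e then t else Γ.len f
    | none => Γ.len e - t
  len_pos
    | some f => by
        by_cases h : f = e
        · simpa [h] using t.2.1
        · simpa [h] using Γ.len_pos f
    | none => sub_pos.2 t.2.2

/-- The same metrized graph, where the point `p` has been added to the set of vertices (if it is
not a vertex already). -/
def subdivide (Γ : MetrizedGraph.{u, v}) : Γ.Point → MetrizedGraph.{u, v}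
  | .vertex _ => Γ
  | .inner e t => Γ.splitEdge e t

/-- The point `p` as a vertex of `Γ.subdivide p`. -/
def subdivideNew (Γ : MetrizedGraph.{u, v}) : (p : Γ.Point) → (Γ.subdivide p).V
  | .vertex a => a
  | .inner _ _ => none

/-- The vertices of `Γ` as vertices of `Γ.subdivide p`. -/
def subdivideOld (Γ : MetrizedGraph.{u, v}) : (p : Γ.Point) → Γ.V → (Γ.subdivide p).V
  | .vertex _, b => b
  | .inner _ _, b => some b

open scoped Classical in
/-- The points of `Γ` as points of `Γ.subdivide p`. -/
def subdividePoint (Γ : MetrizedGraph.{u, v}) :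
    (p : Γ.Point) → Γ.Point → (Γ.subdivide p).Point
  | .vertex _, x => x
  | .inner _ _, .vertex b => .vertex (some b)
  | .inner e t, .inner f s =>
      if f = e ∧ (t : ℝ) ≤ s then (Γ.splitEdge e t).path none ((s : ℝ) - t)
      else (Γ.splitEdge e t).path (some f) s

/-- `Γ_{pq}`: the graph obtained by identifying the points `p` and `q` of `Γ` (they are first made
vertices, `p` and then `q`). -/
def identify (Γ : MetrizedGraph.{u, v}) (p q : Γ.Point) : MetrizedGraph.{u, v} :=
  ((Γ.subdivide p).subdivide (Γ.subdividePoint p q)).identifyVertices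
    ((Γ.subdivide p).subdivideOld (Γ.subdividePoint p q) (Γ.subdivideNew p))
    ((Γ.subdivide p).subdivideNew (Γ.subdividePoint p q))

end

end MetrizedGraph

namespace MetrizedGraph

noncomputable section

/-! Everything reduces to finite linear algebra on the vertices. Let `g` be the Green function of
the weighted graph grounded at a vertex `o`, and extend it to a function G of two points:
interpolate affinely in both variables, and for two points on one edge add the Dirichlet Green
function of that segment (`bump`). Then j_z(x, y) = G(x, y) - G(x, z) - G(z, y) + G(z, z)
(`IsGreen.voltage_eq`), so r(o, x) = G(x, x), a quadratic polynomial on each edge. An explicit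
canonical measure gives τ = ¼ ∫ (d/dx r(o, x))² dx, which is the finite sum `tauSum`
(`IsGreen.tau_eq`); likewise A_{o,q} is the finite sum `ASum` (`IsGreen.A_vertex_eq`).

Both operations in the theorem perturb `g` by a term of rank one. With R = g(q, q) = r(o, q),
identifying `o` with `q` replaces g(x, y) by g(x, y) - κ g(x, q) g(y, q) for κ = 1/R, and joining
them by an edge of length L does so for κ = 1/(L + R). For every κ, `IsGreen.tauSum_sub_rankOne`
says that the tau sum grows by κ (A - R²/2) + κ² R³/3. For κ = 1/R this is A/R - R/6, which is (2)
for vertices. For κ = 1/(L + R), together with the contribution of the new edge, it expresses τ(Γ)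
through τ(Γ - e); contracting `e` amounts to identifying its ends in Γ - e, so comparing the two
formulas gives the first half of (1). The second half follows because a self-loop of length L
contributes L/12.

For arbitrary points in (2), the points are first made vertices: j, hence r and A, and also τ are
unchanged when an edge is subdivided. -/

open scoped Classical in
instance instFintypeV (Γ : MetrizedGraph.{u, v}) : Fintype Γ.V :=
  haveI := Γ.finite_V
  Fintype.ofFinite Γ.V

/-! ### The discrete energy form and Green functions -/

/-- Functions on the vertices that agree at the two ends of every edge are constant. -/
def Rigid (Γ : MetrizedGraph.{u, v}) : Prop :=
  ∀ f : Γ.V → ℝ, (∀ e, f (Γ.src e) = f (Γ.tgt e)) → ∀ a b, f a = f b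

/-- The only consequence of connectedness that the argument needs. It means that the energy form is
degenerate only along constants, and it passes easily to quotients and subdivisions. -/
theorem Connected.rigid {Γ : MetrizedGraph.{u, v}} (h : Γ.Connected) : Γ.Rigid := by
  intro f hf a b
  induction h.2 a b with
  | rel x y h => obtain ⟨e, rfl, rfl⟩ := h; exact hf e
  | refl x => rfl
  | symm x y _ ih => exact ih.symm
  | trans x y z _ _ h₁ h₂ => exact h₁.trans h₂

/-- The energy pairing of two functions on the vertices. -/
def energy (Γ : MetrizedGraph.{u, v}) (f g : Γ.V → ℝ) : ℝ :=
  ∑ e : Γ.E, (f (Γ.tgt e) - f (Γ.src e)) * (g (Γ.tgt e) - g (Γ.src e)) / Γ.len e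

section Energy

variable {Γ : MetrizedGraph.{u, v}}

theorem energy_comm (f g : Γ.V → ℝ) : Γ.energy f g = Γ.energy g f :=
  Finset.sum_congr rfl fun e _ => by ring

theorem energy_add_left (f₁ f₂ g : Γ.V → ℝ) :
    Γ.energy (fun x => f₁ x + f₂ x) g = Γ.energy f₁ g + Γ.energy f₂ g := by
  simp only [energy, ← Finset.sum_add_distrib]
  exact Finset.sum_congr rfl fun e _ => by ring

theorem energy_smul_left (c : ℝ) (f g : Γ.V → ℝ) :
    Γ.energy (fun x => c * f x) g = c * Γ.energy f g := by
  simp only [energy, Finset.mul_sum]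
  exact Finset.sum_congr rfl fun e _ => by ring

theorem energy_sub_left (f₁ f₂ g : Γ.V → ℝ) :
    Γ.energy (fun x => f₁ x - f₂ x) g = Γ.energy f₁ g - Γ.energy f₂ g := by
  simp only [energy, ← Finset.sum_sub_distrib]
  exact Finset.sum_congr rfl fun e _ => by ring

theorem energy_sub_mul_left (c : ℝ) (f₁ f₂ g : Γ.V → ℝ) :
    Γ.energy (fun x => f₁ x - c * f₂ x) g = Γ.energy f₁ g - c * Γ.energy f₂ g := by
  rw [energy_sub_left, energy_smul_left]

theorem energy_sum_right {ι : Type*} (s : Finset ι) (f : Γ.V → ℝ) (g : ι → Γ.V → ℝ) :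
    Γ.energy f (fun x => ∑ i ∈ s, g i x) = ∑ i ∈ s, Γ.energy f (g i) := by
  simp only [energy]
  rw [Finset.sum_comm]
  refine Finset.sum_congr rfl fun e _ => ?_
  rw [← Finset.sum_sub_distrib, Finset.mul_sum, Finset.sum_div]

theorem energy_smul_right (c : ℝ) (f g : Γ.V → ℝ) :
    Γ.energy f (fun x => c * g x) = c * Γ.energy f g := by
  rw [energy_comm, energy_smul_left, energy_comm]

theorem energy_self_nonneg (f : Γ.V → ℝ) : 0 ≤ Γ.energy f f :=
  Finset.sum_nonneg fun e _ => div_nonneg (mul_self_nonneg _) (Γ.len_pos e).le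

theorem Rigid.eq_of_energy_eq_zero (hΓ : Γ.Rigid) {f : Γ.V → ℝ} (h : Γ.energy f f = 0)
    (a b : Γ.V) : f a = f b := by
  refine hΓ f (fun e => ?_) a b
  have h' := (Finset.sum_eq_zero_iff_of_nonneg
    fun e _ => div_nonneg (mul_self_nonneg _) (Γ.len_pos e).le).1 h e (Finset.mem_univ e)
  have := mul_self_eq_zero.1 ((div_eq_zero_iff.1 h').resolve_right (Γ.len_pos e).ne')
  linarith

open scoped Classical in
theorem energy_eq_sum_single (f u : Γ.V → ℝ) :
    Γ.energy f u = ∑ a, u a * Γ.energy f (fun v => if v = a then 1 else 0) := by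
  simp only [← energy_smul_right, ← energy_sum_right]
  congr 1
  ext x
  simp

open scoped Classical in
theorem Rigid.eq_of_forall_energy_single (hΓ : Γ.Rigid) {f : Γ.V → ℝ}
    (h : ∀ a, Γ.energy f (fun v => if v = a then 1 else 0) = 0) (a b : Γ.V) : f a = f b :=
  hΓ.eq_of_energy_eq_zero (by rw [energy_eq_sum_single]; simp [h]) a b

/-- `g` is the Green function of the weighted graph, grounded at the vertex `o`: the discrete
Laplacian of `g (·, y)` is `δ_y - δ_o`, in the weak sense, and `g (o, y) = 0`. -/
structure IsGreen (Γ : MetrizedGraph.{u, v}) (o : Γ.V) (g : Γ.V → Γ.V → ℝ) : Prop where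
  root : ∀ y, g o y = 0
  energy_eq : ∀ (y : Γ.V) (u : Γ.V → ℝ), Γ.energy (fun x => g x y) u = u y - u o

/-- The energy pairing of g(·, x) and g(·, y) can be evaluated by the Green property of either one.
-/
theorem IsGreen.symm {o : Γ.V} {g : Γ.V → Γ.V → ℝ} (hg : Γ.IsGreen o g) (x y : Γ.V) :
    g x y = g y x := by
  have h₁ := hg.energy_eq x fun v => g v y
  have h₂ := hg.energy_eq y fun v => g v x
  rw [energy_comm] at h₂
  simp only [hg.root] at h₁ h₂
  linarith

/-- Adding f(o) u(o) to the energy makes the form nondegenerate, so the functional u ↦ u(y) - u(o)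
is represented by some f. Testing on the constant 1 gives f(o) = 0, and the added term disappears.
-/
theorem Rigid.exists_isGreen (hΓ : Γ.Rigid) (o : Γ.V) : ∃ g, Γ.IsGreen o g := by
  let T : (Γ.V → ℝ) →ₗ[ℝ] Module.Dual ℝ (Γ.V → ℝ) :=
    LinearMap.mk₂ ℝ (fun f u => Γ.energy f u + f o * u o)
      (fun f₁ f₂ u => by
        have := energy_add_left f₁ f₂ u
        simp only [Pi.add_apply] at *
        linear_combination this)
      (fun c f u => by
        have := energy_smul_left c f u
        simp only [Pi.smul_apply, smul_eq_mul] at *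
        linear_combination this)
      (fun f u₁ u₂ => by
        have := energy_add_left u₁ u₂ f
        rw [energy_comm f, energy_comm f, energy_comm f]
        simp only [Pi.add_apply] at *
        linear_combination this)
      (fun c f u => by
        have := energy_smul_right c f u
        simp only [Pi.smul_apply, smul_eq_mul] at *
        linear_combination this)
  have hT : ∀ f u, T f u = Γ.energy f u + f o * u o := fun _ _ => rfl
  have hinj : Function.Injective T := by
    refine (injective_iff_map_eq_zero T).2 fun f hf => ?_
    have h := hT f f
    rw [hf, LinearMap.zero_apply] at h
    have h₁ := energy_self_nonneg f
    have h₂ := mul_self_nonneg (f o)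
    ext a
    rw [hΓ.eq_of_energy_eq_zero (f := f) (by linarith) a o]
    exact mul_self_eq_zero.1 (by linarith)
  have hsurj : Function.Surjective T :=
    (LinearMap.injective_iff_surjective_of_finrank_eq_finrank
      (Subspace.dual_finrank_eq (K := ℝ) (V := Γ.V → ℝ)).symm).1 hinj
  choose g hg using fun y : Γ.V => hsurj
    ((LinearMap.proj y : (Γ.V → ℝ) →ₗ[ℝ] ℝ) - (LinearMap.proj o : (Γ.V → ℝ) →ₗ[ℝ] ℝ))
  have hg' : ∀ y u, Γ.energy (g y) u + g y o * u o = u y - u o := fun y u => by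
    rw [← hT, hg]; rfl
  have hroot : ∀ y, g y o = 0 := fun y => by
    have := hg' y fun _ => 1
    simpa [energy] using this
  exact ⟨fun x y => g y x, hroot, fun y u => by simpa [hroot] using hg' y u⟩

end Energy

/-! ### The tau constant and `A` in terms of a Green function -/

/-- For a Green function `g`, the quotient of the effective resistance between the end points of
`e` by the length of `e`. -/
def foster (Γ : MetrizedGraph.{u, v}) (g : Γ.V → Γ.V → ℝ) (e : Γ.E) : ℝ :=
  (g (Γ.src e) (Γ.src e) - 2 * g (Γ.src e) (Γ.tgt e) + g (Γ.tgt e) (Γ.tgt e)) / Γ.len e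

/-- The contribution of the edge `e` to the tau constant. -/
def tauTerm (Γ : MetrizedGraph.{u, v}) (g : Γ.V → Γ.V → ℝ) (e : Γ.E) : ℝ :=
  Γ.len e / 12 * (1 - Γ.foster g e) ^ 2 +
    (g (Γ.tgt e) (Γ.tgt e) - g (Γ.src e) (Γ.src e)) ^ 2 / (4 * Γ.len e)

/-- The tau constant, in terms of a Green function. -/
def tauSum (Γ : MetrizedGraph.{u, v}) (g : Γ.V → Γ.V → ℝ) : ℝ := ∑ e : Γ.E, Γ.tauTerm g e

/-- `A_{o,q}` for vertices `o` and `q`, in terms of the Green function `g` grounded at `o`. -/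
def ASum (Γ : MetrizedGraph.{u, v}) (g : Γ.V → Γ.V → ℝ) (q : Γ.V) : ℝ :=
  ∑ e : Γ.E, ((g (Γ.tgt e) q - g (Γ.src e) q) / Γ.len e) ^ 2 *
    (Γ.len e * (g (Γ.src e) (Γ.src e) + g (Γ.tgt e) (Γ.tgt e) - g (Γ.src e) q - g (Γ.tgt e) q) / 2
      + Γ.len e ^ 2 * (1 - Γ.foster g e) / 6)

section Discrete

variable {Γ : MetrizedGraph.{u, v}} {o : Γ.V} {g : Γ.V → Γ.V → ℝ}

/-- The effect of a perturbation of rank one of the Green function. -/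
theorem IsGreen.tauSum_sub_rankOne (hg : Γ.IsGreen o g) (q : Γ.V) (κ : ℝ) :
    Γ.tauSum (fun x y => g x y - κ * g x q * g y q) =
      Γ.tauSum g + κ * (Γ.ASum g q - g q q ^ 2 / 2) + κ ^ 2 * g q q ^ 3 / 3 := by
  -- Expanding the perturbed sum edge by edge leaves, besides the two sums for τ and A, only energy
  -- pairings of g(·, q) with these three functions. The Green property evaluates them at q, as R³,
  -- R² and R² with R = g(q, q).
  have h₁ := hg.energy_eq q fun v => g v q ^ 3
  have h₂ := hg.energy_eq q fun v => g v q ^ 2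
  have h₃ := hg.energy_eq q fun v => g v v * g v q
  simp only [hg.root, zero_pow, ne_eq, OfNat.ofNat_ne_zero, not_false_eq_true, sub_zero,
    mul_zero] at h₁ h₂ h₃
  suffices h : Γ.tauSum (fun x y => g x y - κ * g x q * g y q) = Γ.tauSum g + κ * Γ.ASum g q
      - κ * Γ.energy (fun x => g x q) (fun v => g v v * g v q)
      + κ / 2 * Γ.energy (fun x => g x q) (fun v => g v q ^ 2)
      + κ ^ 2 / 3 * Γ.energy (fun x => g x q) (fun v => g v q ^ 3) by
    rw [h, h₁, h₂, h₃]; ring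
  simp only [tauSum, ASum, energy, Finset.mul_sum, ← Finset.sum_add_distrib,
    ← Finset.sum_sub_distrib]
  refine Finset.sum_congr rfl fun e _ => ?_
  have := (Γ.len_pos e).ne'
  simp only [tauTerm, foster]
  field_simp
  ring

end Discrete

/-! ### Identification of vertices and deletion of edges -/

section Discrete

variable {Γ : MetrizedGraph.{u, v}} {o : Γ.V} {g : Γ.V → Γ.V → ℝ}

/-- The value is the energy of g(·, q). If it were zero, g(·, q) would be constant, but its pairing
with the indicator of q is 1. -/
theorem IsGreen.apply_self_pos (hg : Γ.IsGreen o g) (hΓ : Γ.Rigid) {q : Γ.V} (hq : o ≠ q) :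
    0 < g q q := by
  classical
  have h := hg.energy_eq q fun v => g v q
  simp only [hg.root, sub_zero] at h
  refine lt_of_le_of_ne (h ▸ energy_self_nonneg _) fun h0 => ?_
  have hc := hΓ.eq_of_energy_eq_zero (h.trans h0.symm)
  have h1 := hg.energy_eq q fun v => if v = q then 1 else 0
  have h2 : Γ.energy (fun x => g x q) (fun v => if v = q then 1 else 0) = 0 :=
    Finset.sum_eq_zero fun e _ => by simp [hc (Γ.tgt e) (Γ.src e)]
  rw [h2] at h1
  simp [hq] at h1

theorem Rigid.identifyVertices (hΓ : Γ.Rigid) (a b : Γ.V) : (Γ.identifyVertices a b).Rigid := by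
  intro f hf x y
  induction x using Quot.ind with | _ x => ?_
  induction y using Quot.ind with | _ y => ?_
  exact hΓ (fun v => f (Quot.mk _ v)) hf x y

theorem Rigid.of_deleteEdge {e : Γ.E} (h : (Γ.deleteEdge e).Rigid) : Γ.Rigid :=
  fun f hf => h f fun e' => hf e'.1

/-- The subtracted multiple of g(·, q) is the one that makes the values at p and q equal, so the
function descends to the quotient. It changes the Laplacian by a multiple of δ_q - δ_p, which
vanishes there. For p = q the factor is the inverse of 0, that is 0, and nothing is subtracted. -/
theorem IsGreen.exists_identifyVertices {p q : Γ.V} (hg : Γ.IsGreen p g) (hΓ : Γ.Rigid) :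
    ∃ g', (Γ.identifyVertices p q).IsGreen (Quot.mk _ p) g' ∧
      ∀ x y : Γ.V, g' (Quot.mk _ x) (Quot.mk _ y) =
        g x y - (g q q)⁻¹ * g x q * g y q := by
  have key : ∀ y, g p y - (g q q)⁻¹ * g p q * g y q = g q y - (g q q)⁻¹ * g q q * g y q := by
    intro y
    by_cases hpq : p = q
    · rw [hpq]
    · have := (hg.apply_self_pos hΓ hpq).ne'
      rw [hg.root, hg.root, hg.symm q y]
      field_simp
      ring
  have key' : ∀ x, g x p - (g q q)⁻¹ * g x q * g p q = g x q - (g q q)⁻¹ * g x q * g q q := by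
    intro x
    have := key x
    rw [hg.symm x p, hg.symm x q] at *
    linear_combination this
  let g' : (Γ.identifyVertices p q).V → (Γ.identifyVertices p q).V → ℝ :=
    Quot.lift (fun x => Quot.lift (fun y => g x y - (g q q)⁻¹ * g x q * g y q)
      (by rintro _ _ ⟨rfl, rfl⟩; exact key' x))
      (by
        rintro _ _ ⟨rfl, rfl⟩
        ext y
        induction y using Quot.ind with | _ y => exact key y)
  refine ⟨g', ⟨fun y => ?_, fun y u => ?_⟩, fun x y => rfl⟩
  · induction y using Quot.ind with | _ y => ?_
    change g p y - (g q q)⁻¹ * g p q * g y q = 0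
    rw [hg.root, hg.root]
    ring
  · induction y using Quot.ind with | _ y => ?_
    have hpq : (Quot.mk _ q : (Γ.identifyVertices p q).V) = Quot.mk _ p :=
      (Quot.sound ⟨rfl, rfl⟩).symm
    change Γ.energy (fun x => g x y - (g q q)⁻¹ * g x q * g y q) (fun x => u (Quot.mk _ x)) = _
    have h1 : Γ.energy (fun x => g x y - (g q q)⁻¹ * g x q * g y q) (fun x => u (Quot.mk _ x))
        = Γ.energy (fun x => g x y) (fun x => u (Quot.mk _ x))
          - (g q q)⁻¹ * g y q * Γ.energy (fun x => g x q) (fun x => u (Quot.mk _ x)) := by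
      rw [← energy_sub_mul_left]
      congr 1
      ext x
      ring
    rw [h1, hg.energy_eq, hg.energy_eq, hpq]
    ring

theorem sum_deleteEdge (e : Γ.E) (φ : Γ.E → ℝ) :
    ∑ f : Γ.E, φ f = φ e + ∑ f : (Γ.deleteEdge e).E, φ f.1 := by
  classical
  rw [Fintype.sum_eq_add_sum_subtype_ne φ e]
  congr 1
  exact @Fintype.sum_equiv {f : Γ.E // f ≠ e} (Γ.deleteEdge e).E ℝ (Subtype.fintype _)
    (Γ.deleteEdge e).instFintypeE _ (Equiv.refl _) _ _ fun _ => rfl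

/-- Restoring the edge adds a form of rank one to the energy, so this is the Sherman–Morrison
formula. The denominator is nonzero because g(q, q), for q the target of `e`, is an energy. -/
theorem IsGreen.of_deleteEdge {e : Γ.E} (hg : (Γ.deleteEdge e).IsGreen (Γ.src e) g) :
    Γ.IsGreen (Γ.src e) fun x y => g x y -
      (Γ.len e + g (Γ.tgt e) (Γ.tgt e))⁻¹ * g x (Γ.tgt e) * g y (Γ.tgt e) := by
  have hnn : 0 ≤ g (Γ.tgt e) (Γ.tgt e) := by
    have h := hg.energy_eq (Γ.tgt e) fun v => g v (Γ.tgt e)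
    have h' := hg.root (Γ.tgt e)
    have := energy_self_nonneg (Γ := Γ.deleteEdge e) (fun v => g v (Γ.tgt e))
    linarith
  have hL := Γ.len_pos e
  refine ⟨fun y => ?_, fun y u => ?_⟩
  · have h1 := hg.root y
    have h2 := hg.root (Γ.tgt e)
    simp only [h1, h2]
    ring
  · simp only [energy]
    rw [sum_deleteEdge e]
    set R := g (Γ.tgt e) (Γ.tgt e) with hR
    have h1 := hg.energy_eq y u
    have h2 := hg.energy_eq (Γ.tgt e) u
    have h3 := hg.root y
    have h4 := hg.root (Γ.tgt e)
    have h5 := hg.symm (Γ.tgt e) y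
    have h6 : (∑ f : (Γ.deleteEdge e).E,
        (g (Γ.tgt f.1) y - (Γ.len e + R)⁻¹ * g (Γ.tgt f.1) (Γ.tgt e) * g y (Γ.tgt e) -
          (g (Γ.src f.1) y - (Γ.len e + R)⁻¹ * g (Γ.src f.1) (Γ.tgt e) * g y (Γ.tgt e))) *
          (u (Γ.tgt f.1) - u (Γ.src f.1)) / Γ.len f.1) =
        (Γ.deleteEdge e).energy (fun x => g x y) u - (Γ.len e + R)⁻¹ * g y (Γ.tgt e) *
          (Γ.deleteEdge e).energy (fun x => g x (Γ.tgt e)) u := by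
      refine (Finset.sum_congr rfl fun f _ => ?_).trans (energy_sub_mul_left (Γ := Γ.deleteEdge e)
        ((Γ.len e + R)⁻¹ * g y (Γ.tgt e)) (fun x => g x y) (fun x => g x (Γ.tgt e)) u)
      dsimp only [deleteEdge]
      ring
    rw [h6, h1, h2, h3, h4, h5]
    have : Γ.len e + R ≠ 0 := by positivity
    field_simp
    ring

theorem tauSum_eq_add_deleteEdge (e : Γ.E) :
    Γ.tauSum g = Γ.tauTerm g e + (Γ.deleteEdge e).tauSum g :=
  sum_deleteEdge e fun f => Γ.tauTerm g f

/-- The last two terms are the contribution of `e` itself, between whose ends the resistance in Γ is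
LR/(L + R). The others come from the rank-one formula on Γ - e with κ = 1/(L + R). -/
theorem IsGreen.tauSum_of_deleteEdge {e : Γ.E} (hg : (Γ.deleteEdge e).IsGreen (Γ.src e) g)
    {L R A : ℝ} (hL : L = Γ.len e) (hR : R = g (Γ.tgt e) (Γ.tgt e))
    (hA : A = (Γ.deleteEdge e).ASum g (Γ.tgt e)) :
    Γ.tauSum (fun x y => g x y - (L + R)⁻¹ * g x (Γ.tgt e) * g y (Γ.tgt e)) =
      (Γ.deleteEdge e).tauSum g + (A - R ^ 2 / 2) / (L + R) + R ^ 3 / (3 * (L + R) ^ 2)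
        + L ^ 3 / (12 * (L + R) ^ 2) + R ^ 2 * L / (4 * (L + R) ^ 2) := by
  have hnn : 0 ≤ R := by
    have h := hg.energy_eq (Γ.tgt e) fun v => g v (Γ.tgt e)
    have h' := hg.root (Γ.tgt e)
    have := energy_self_nonneg (Γ := Γ.deleteEdge e) (fun v => g v (Γ.tgt e))
    linarith
  have hL' : 0 < L := hL ▸ Γ.len_pos e
  rw [tauSum_eq_add_deleteEdge e]
  erw [hg.tauSum_sub_rankOne (Γ.tgt e) (L + R)⁻¹]
  have h3 : ∀ y, g (Γ.src e) y = 0 := hg.root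
  rw [← hA, ← hR]
  simp only [tauTerm, foster, h3, ← hR, ← hL]
  have : L + R ≠ 0 := by positivity
  field_simp
  ring

end Discrete

/-! ### Paths and points -/

section Path

variable {Γ : MetrizedGraph.{u, v}}

theorem path_of_mem {e : Γ.E} {t : ℝ} (h : t ∈ Ioo 0 (Γ.len e)) :
    Γ.path e t = .inner e ⟨t, h⟩ := by
  simp [path, h.1, h.2]

theorem path_of_nonpos {e : Γ.E} {t : ℝ} (h : t ≤ 0) : Γ.path e t = .vertex (Γ.src e) := by
  have : ¬ t ∈ Ioo 0 (Γ.len e) := fun h' => absurd h'.1 h.not_gt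
  simp only [path, this, h, dite_false, if_true]

theorem path_of_len_le {e : Γ.E} {t : ℝ} (h : Γ.len e ≤ t) :
    Γ.path e t = .vertex (Γ.tgt e) := by
  have h1 : ¬ t ∈ Ioo 0 (Γ.len e) := fun h' => absurd h'.2 h.not_gt
  have h2 : ¬ t ≤ 0 := not_le.2 ((Γ.len_pos e).trans_le h)
  simp only [path, h1, h2, dite_false, if_false]

@[simp]
theorem path_zero (e : Γ.E) : Γ.path e 0 = .vertex (Γ.src e) := path_of_nonpos le_rfl

@[simp]
theorem path_len (e : Γ.E) : Γ.path e (Γ.len e) = .vertex (Γ.tgt e) := path_of_len_le le_rfl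

theorem path_max_min (e : Γ.E) (t : ℝ) : Γ.path e (max 0 (min t (Γ.len e))) = Γ.path e t := by
  have := Γ.len_pos e
  rcases le_total t 0 with h | h
  · rw [path_of_nonpos h, path_of_nonpos]
    exact max_le le_rfl ((min_le_left _ _).trans h)
  · rcases le_total (Γ.len e) t with h' | h'
    · rw [path_of_len_le h', path_of_len_le]
      exact le_max_of_le_right (le_min h' le_rfl)
    · rw [min_eq_left h', max_eq_right h]

theorem max_min_mem (e : Γ.E) (t : ℝ) : max 0 (min t (Γ.len e)) ∈ Icc 0 (Γ.len e) :=
  ⟨le_max_left _ _, max_le (Γ.len_pos e).le (min_le_right _ _)⟩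

theorem mem_Icc_cases {L t : ℝ} (h : t ∈ Icc 0 L) : t = 0 ∨ t = L ∨ t ∈ Ioo 0 L := by
  rcases h.1.eq_or_lt with h1 | h1
  · exact .inl h1.symm
  · rcases h.2.eq_or_lt with h2 | h2
    · exact .inr (.inl h2)
    · exact .inr (.inr ⟨h1, h2⟩)

theorem injOn_path (e : Γ.E) : InjOn (Γ.path e) (Ioo 0 (Γ.len e)) := by
  intro s hs t ht h
  rw [path_of_mem hs, path_of_mem ht] at h
  simpa using h

theorem continuous_path (e : Γ.E) : Continuous (Γ.path e) :=
  continuous_iff_coinduced_le.2 (le_iSup (fun e => TopologicalSpace.coinduced (Γ.path e) _) e)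

theorem continuous_point_iff {Y : Type*} [TopologicalSpace Y] {f : Γ.Point → Y} :
    Continuous f ↔ ∀ e, Continuous fun t => f (Γ.path e t) :=
  ⟨fun h e => h.comp (continuous_path e),
    fun h => continuous_iSup_dom.2 fun e => continuous_coinduced_dom.2 (h e)⟩

theorem continuous_of_eqOn_path {f : Γ.Point → ℝ} {φ : Γ.E → ℝ → ℝ} (hφ : ∀ e, Continuous (φ e))
    (h : ∀ e, ∀ t ∈ Icc 0 (Γ.len e), f (Γ.path e t) = φ e t) : Continuous f := by
  refine continuous_point_iff.2 fun e => ?_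
  -- The parametrization is constant outside [0, len], so clamping the parameter reduces continuity
  -- on the line to the formula on the segment.
  have : (fun t => f (Γ.path e t)) = fun t => φ e (max 0 (min t (Γ.len e))) := by
    ext t
    rw [← h e _ (max_min_mem e t), path_max_min]
  rw [this]
  exact (hφ e).comp (by fun_prop)

instance : CompactSpace Γ.Point := by
  have hfin : Finite Γ.V := Γ.finite_V
  refine ⟨?_⟩
  -- The vertices are listed separately because without connectedness a vertex need not be the end
  -- of an edge.
  have : (univ : Set Γ.Point) =
      range Point.vertex ∪ ⋃ e, Γ.path e '' Icc 0 (Γ.len e) := by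
    refine (eq_univ_of_forall fun x => ?_).symm
    cases x with
    | vertex a => exact .inl ⟨a, rfl⟩
    | inner e t =>
      exact .inr (mem_iUnion.2 ⟨e, t, ⟨t.2.1.le, t.2.2.le⟩, path_of_mem t.2⟩)
  rw [this]
  exact (finite_range _).isCompact.union
    (isCompact_iUnion fun e => isCompact_Icc.image (continuous_path e))

end Path

/-! ### The Green function on the points of the graph -/

/-- The affine function on the edge `e` with prescribed values at the end points. -/
def lin (Γ : MetrizedGraph.{u, v}) (e : Γ.E) (F : Γ.V → ℝ) (s : ℝ) : ℝ :=
  F (Γ.src e) + (F (Γ.tgt e) - F (Γ.src e)) / Γ.len e * s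

/-- The extension of a function on the vertices that is affine on the edges. -/
def interp (Γ : MetrizedGraph.{u, v}) (F : Γ.V → ℝ) : Γ.Point → ℝ
  | .vertex a => F a
  | .inner e t => Γ.lin e F t

open scoped Classical in
/-- The Green function of the Dirichlet problem on the segment `e`. -/
def bump (Γ : MetrizedGraph.{u, v}) (e : Γ.E) : Γ.Point → ℝ → ℝ
  | .vertex _, _ => 0
  | .inner f u, s => if f = e then min s u - s * u / Γ.len e else 0

/-- The extension of a Green function to the points of the metrized graph. -/
def green (Γ : MetrizedGraph.{u, v}) (g : Γ.V → Γ.V → ℝ) : Γ.Point → Γ.Point → ℝ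
  | .vertex a, y => Γ.interp (g a) y
  | .inner e s, y => Γ.lin e (fun v => Γ.interp (g v) y) s + Γ.bump e y s

section Green

variable {Γ : MetrizedGraph.{u, v}} {o : Γ.V} {g : Γ.V → Γ.V → ℝ}

@[simp]
theorem lin_zero (e : Γ.E) (F : Γ.V → ℝ) : Γ.lin e F 0 = F (Γ.src e) := by simp [lin]

@[simp]
theorem lin_len (e : Γ.E) (F : Γ.V → ℝ) : Γ.lin e F (Γ.len e) = F (Γ.tgt e) := by
  have := (Γ.len_pos e).ne'
  simp [lin, this]

theorem interp_path {e : Γ.E} {s : ℝ} (F : Γ.V → ℝ) (hs : s ∈ Icc 0 (Γ.len e)) :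
    Γ.interp F (Γ.path e s) = Γ.lin e F s := by
  rcases mem_Icc_cases hs with rfl | rfl | h
  · simp [interp]
  · simp [interp]
  · rw [path_of_mem h]; rfl

@[simp]
theorem bump_zero (e : Γ.E) (y : Γ.Point) : Γ.bump e y 0 = 0 := by
  cases y with
  | vertex a => rfl
  | inner f u =>
    by_cases h : f = e
    · simp [bump, u.2.1.le]
    · simp [bump, h]

@[simp]
theorem bump_len (e : Γ.E) (y : Γ.Point) : Γ.bump e y (Γ.len e) = 0 := by
  cases y with
  | vertex a => rfl
  | inner f u =>
    by_cases h : f = e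
    · subst h
      have := (Γ.len_pos f).ne'
      simp only [bump, if_true, min_eq_right u.2.2.le]
      field_simp
      ring
    · simp [bump, h]

theorem green_path {e : Γ.E} {s : ℝ} (g : Γ.V → Γ.V → ℝ) (y : Γ.Point)
    (hs : s ∈ Icc 0 (Γ.len e)) :
    Γ.green g (Γ.path e s) y = Γ.lin e (fun v => Γ.interp (g v) y) s + Γ.bump e y s := by
  rcases mem_Icc_cases hs with rfl | rfl | h
  · simp [green]
  · simp [green]
  · rw [path_of_mem h]; rfl

theorem green_symm (hg : ∀ x y, g x y = g y x) (x y : Γ.Point) :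
    Γ.green g x y = Γ.green g y x := by
  cases x with
  | vertex a =>
    cases y with
    | vertex b => exact hg a b
    | inner f u => simp [green, interp, bump, lin, hg a]
  | inner e s =>
    cases y with
    | vertex b => simp [green, interp, bump, lin, hg b]
    | inner f u =>
      by_cases h : f = e
      · subst h
        simp only [green, interp, bump, lin, if_true, hg (Γ.tgt f) (Γ.src f), min_comm (s : ℝ)]
        ring
      · simp only [green, interp, bump, lin, h, Ne.symm h, if_false, hg (Γ.tgt f), hg (Γ.src f)]
        ring

theorem continuous_green (g : Γ.V → Γ.V → ℝ) (y : Γ.Point) :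
    Continuous fun x => Γ.green g x y := by
  refine continuous_of_eqOn_path (fun e => ?_) fun e t ht => green_path g y ht
  cases y with
  | vertex a => simp only [lin, bump]; fun_prop
  | inner f u =>
    by_cases h : f = e
    · simp only [lin, bump, h, if_true]; fun_prop
    · simp only [lin, bump, h, if_false]; fun_prop

end Green

/-! ### Piecewise affine functions -/

/-- The derivative is locally constant, hence constant on the interval; after subtracting the
corresponding linear function the derivative is zero. -/
theorem exists_affine_of_locally_affine {φ : ℝ → ℝ} {l r : ℝ}
    (h : ∀ t ∈ Ioo l r, ∃ a b : ℝ, ∀ᶠ s in 𝓝 t, φ s = a + b * s) :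
    ∃ a b : ℝ, ∀ s ∈ Ioo l r, φ s = a + b * s := by
  rcases (Ioo l r).eq_empty_or_nonempty with he | ⟨c, hc⟩
  · exact ⟨0, 0, by simp [he]⟩
  have hder : ∀ a b s : ℝ, HasDerivAt (fun s => a + b * s) b s := fun a b s => by
    simpa using ((hasDerivAt_id s).const_mul b).const_add a
  have h1 : ∀ t ∈ Ioo l r, ∃ b : ℝ, ∀ᶠ s in 𝓝 t, HasDerivAt φ b s := fun t ht => by
    obtain ⟨a, b, hab⟩ := h t ht
    exact ⟨b, hab.eventually_nhds.mono fun s hs => (hder a b s).congr_of_eventuallyEq hs⟩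
  have h2 : ∀ t ∈ Ioo l r, HasDerivAt (deriv φ) 0 t := fun t ht => by
    obtain ⟨b, hb⟩ := h1 t ht
    exact (hasDerivAt_const t b).congr_of_eventuallyEq (hb.mono fun s hs => hs.deriv)
  have h3 : ∀ t ∈ Ioo l r, deriv φ t = deriv φ c := fun t ht =>
    isOpen_Ioo.is_const_of_deriv_eq_zero isPreconnected_Ioo
      (fun t ht => (h2 t ht).differentiableAt.differentiableWithinAt)
      (fun t ht => (h2 t ht).deriv) ht hc
  have h4 : ∀ t ∈ Ioo l r, HasDerivAt (fun s => φ s - deriv φ c * s) 0 t := fun t ht => by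
    obtain ⟨b, hb⟩ := h1 t ht
    have h5 := hb.self_of_nhds
    have h6 := h3 t ht
    rw [h5.deriv] at h6
    simpa [h6] using h5.fun_sub ((hasDerivAt_id' t).const_mul (deriv φ c))
  refine ⟨φ c - deriv φ c * c, deriv φ c, fun t ht => ?_⟩
  have := isOpen_Ioo.is_const_of_deriv_eq_zero isPreconnected_Ioo
      (fun t ht => (h4 t ht).differentiableAt.differentiableWithinAt)
      (fun t ht => (h4 t ht).deriv) ht hc
  linarith

/-- A short interval to the right of t contains no exceptional point, and continuity extends the
affine formula to t even if t is exceptional. This makes one-sided slopes exist everywhere. -/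
theorem exists_affine_right {φ : ℝ → ℝ} (hφ : Continuous φ) {S : Set ℝ} (hS : S.Finite)
    {t r : ℝ} (htr : t < r)
    (h : ∀ s ∈ Ioo t r, s ∉ S → ∃ a b : ℝ, ∀ᶠ s' in 𝓝 s, φ s' = a + b * s') :
    ∃ a b : ℝ, ∀ᶠ s in 𝓝[≥] t, φ s = a + b * s := by
  have h1 : (S \ {t})ᶜ ∈ 𝓝[>] t :=
    mem_nhdsWithin_of_mem_nhds ((hS.subset sdiff_subset).isClosed.isOpen_compl.mem_nhds (by simp))
  obtain ⟨w, hw, hw'⟩ := mem_nhdsGT_iff_exists_Ioo_subset.1 (inter_mem h1 (Ioo_mem_nhdsGT htr))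
  obtain ⟨a, b, hab⟩ := exists_affine_of_locally_affine (φ := φ) (l := t) (r := w) fun s hs => by
    have h2 := hw' hs
    exact h s h2.2 fun h3 => h2.1 ⟨h3, hs.1.ne'⟩
  have hev : ∀ᶠ s in 𝓝[>] t, φ s = a + b * s := by
    filter_upwards [Ioo_mem_nhdsGT hw] with s hs using hab s hs
  have ht : φ t = a + b * t := by
    have h3 : Tendsto φ (𝓝[>] t) (𝓝 (φ t)) := hφ.continuousAt.mono_left inf_le_left
    have h4 : Tendsto (fun s => a + b * s) (𝓝[>] t) (𝓝 (a + b * t)) :=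
      (by fun_prop : Continuous fun s => a + b * s).continuousAt.mono_left inf_le_left
    exact tendsto_nhds_unique h3 (h4.congr' (hev.mono fun s hs => hs.symm))
  refine ⟨a, b, ?_⟩
  filter_upwards [Ico_mem_nhdsGE hw] with s hs
  rcases hs.1.eq_or_lt with rfl | h'
  · exact ht
  · exact hab s ⟨h', hs.2⟩

theorem exists_affine_left {φ : ℝ → ℝ} (hφ : Continuous φ) {S : Set ℝ} (hS : S.Finite)
    {t r : ℝ} (htr : r < t)
    (h : ∀ s ∈ Ioo r t, s ∉ S → ∃ a b : ℝ, ∀ᶠ s' in 𝓝 s, φ s' = a + b * s') :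
    ∃ a b : ℝ, ∀ᶠ s in 𝓝[≤] t, φ s = a + b * s := by
  obtain ⟨a, b, hab⟩ := exists_affine_right (φ := fun s => φ (-s)) (by fun_prop)
    (S := -S) hS.neg (t := -t) (r := -r) (by linarith) fun s hs hsS => by
      obtain ⟨a, b, hab⟩ := h (-s) ⟨by linarith [hs.2], by linarith [hs.1]⟩ (by simpa using hsS)
      exact ⟨a, -b, ((continuous_neg.tendsto s).eventually hab).mono fun x hx => by
        rw [hx]; ring⟩
  refine ⟨a, -b, ?_⟩
  have h1 : Tendsto (fun s : ℝ => -s) (𝓝[≤] t) (𝓝[≥] (-t)) :=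
    tendsto_nhdsWithin_iff.2 ⟨(continuous_neg.tendsto t).mono_left inf_le_left, by
      filter_upwards [self_mem_nhdsWithin] with s hs using neg_le_neg (mem_Iic.1 hs)⟩
  refine (h1.eventually hab).mono fun s hs => ?_
  rw [neg_neg] at hs
  rw [hs]; ring

theorem hasDerivWithinAt_affine {φ : ℝ → ℝ} {s : Set ℝ} {t a b : ℝ} (ht : t ∈ s)
    (h : ∀ᶠ x in 𝓝[s] t, φ x = a + b * x) : HasDerivWithinAt φ b s t := by
  have : HasDerivWithinAt (fun x => a + b * x) b s t := by
    simpa using (((hasDerivAt_id t).const_mul b).const_add a).hasDerivWithinAt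
  exact this.congr_of_eventuallyEq h (h.self_of_nhdsWithin ht)

section PiecewiseAffine

variable {Γ : MetrizedGraph.{u, v}} {f f₁ f₂ : Γ.Point → ℝ}

theorem IsPiecewiseAffine.exists_finite (hf : Γ.IsPiecewiseAffine f) (e : Γ.E) :
    ∃ S : Set ℝ, S.Finite ∧ ∀ t ∈ Ioo 0 (Γ.len e), t ∉ S →
      ∃ a b : ℝ, ∀ᶠ s in 𝓝 t, f (Γ.path e s) = a + b * s := by
  obtain ⟨-, S, hS, h⟩ := hf
  refine ⟨{t ∈ Ioo 0 (Γ.len e) | Γ.path e t ∈ S}, ?_, fun t ht hts => h e t ht fun h' =>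
    hts ⟨ht, h'⟩⟩
  refine Finite.of_finite_image (hS.subset ?_) ((injOn_path e).mono fun t ht => ht.1)
  rintro _ ⟨t, ht, rfl⟩
  exact ht.2

theorem IsPiecewiseAffine.exists_right (hf : Γ.IsPiecewiseAffine f) {e : Γ.E} {t : ℝ}
    (ht : t ∈ Ico 0 (Γ.len e)) :
    ∃ a b : ℝ, ∀ᶠ s in 𝓝[≥] t, f (Γ.path e s) = a + b * s := by
  obtain ⟨S, hS, h⟩ := hf.exists_finite e
  exact exists_affine_right (hf.1.comp (continuous_path e)) hS ht.2
    fun s hs => h s ⟨ht.1.trans_lt hs.1, hs.2⟩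

theorem IsPiecewiseAffine.exists_left (hf : Γ.IsPiecewiseAffine f) {e : Γ.E} {t : ℝ}
    (ht : t ∈ Ioc 0 (Γ.len e)) :
    ∃ a b : ℝ, ∀ᶠ s in 𝓝[≤] t, f (Γ.path e s) = a + b * s := by
  obtain ⟨S, hS, h⟩ := hf.exists_finite e
  exact exists_affine_left (hf.1.comp (continuous_path e)) hS ht.1
    fun s hs => h s ⟨hs.1, hs.2.trans_le ht.2⟩

theorem IsPiecewiseAffine.differentiableWithinAt_right (hf : Γ.IsPiecewiseAffine f) {e : Γ.E}
    {t : ℝ} (ht : t ∈ Ico 0 (Γ.len e)) :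
    DifferentiableWithinAt ℝ (fun s => f (Γ.path e s)) (Ici t) t := by
  obtain ⟨a, b, h⟩ := hf.exists_right ht
  exact (hasDerivWithinAt_affine self_mem_Ici h).differentiableWithinAt

theorem IsPiecewiseAffine.differentiableWithinAt_left (hf : Γ.IsPiecewiseAffine f) {e : Γ.E}
    {t : ℝ} (ht : t ∈ Ioc 0 (Γ.len e)) :
    DifferentiableWithinAt ℝ (fun s => f (Γ.path e s)) (Iic t) t := by
  obtain ⟨a, b, h⟩ := hf.exists_left ht
  exact (hasDerivWithinAt_affine self_mem_Iic h).differentiableWithinAt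

theorem IsPiecewiseAffine.sub (h₁ : Γ.IsPiecewiseAffine f₁) (h₂ : Γ.IsPiecewiseAffine f₂) :
    Γ.IsPiecewiseAffine fun x => f₁ x - f₂ x := by
  obtain ⟨c₁, S₁, hS₁, h₁⟩ := h₁
  obtain ⟨c₂, S₂, hS₂, h₂⟩ := h₂
  refine ⟨c₁.sub c₂, S₁ ∪ S₂, hS₁.union hS₂, fun e t ht hS => ?_⟩
  obtain ⟨a₁, b₁, h₁⟩ := h₁ e t ht fun h => hS (.inl h)
  obtain ⟨a₂, b₂, h₂⟩ := h₂ e t ht fun h => hS (.inr h)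
  exact ⟨a₁ - a₂, b₁ - b₂, by filter_upwards [h₁, h₂] with s hs hs'; rw [hs, hs']; ring⟩

theorem isPiecewiseAffine_const (c : ℝ) : Γ.IsPiecewiseAffine fun _ => c :=
  ⟨continuous_const, ∅, finite_empty, fun _ _ _ _ => ⟨c, 0, by simp⟩⟩

theorem slopeSum_const (c : ℝ) (x : Γ.Point) : Γ.slopeSum (fun _ => c) x = 0 := by
  cases x <;> simp [slopeSum]

theorem IsPiecewiseAffine.slopeSum_sub (h₁ : Γ.IsPiecewiseAffine f₁)
    (h₂ : Γ.IsPiecewiseAffine f₂) (x : Γ.Point) :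
    Γ.slopeSum (fun x => f₁ x - f₂ x) x = Γ.slopeSum f₁ x - Γ.slopeSum f₂ x := by
  have hr : ∀ e, ∀ t ∈ Ico 0 (Γ.len e),
      derivWithin (fun s => f₁ (Γ.path e s) - f₂ (Γ.path e s)) (Ici t) t =
        derivWithin (fun s => f₁ (Γ.path e s)) (Ici t) t -
          derivWithin (fun s => f₂ (Γ.path e s)) (Ici t) t := fun e t ht =>
    derivWithin_fun_sub (h₁.differentiableWithinAt_right ht) (h₂.differentiableWithinAt_right ht)
  have hl : ∀ e, ∀ t ∈ Ioc 0 (Γ.len e),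
      derivWithin (fun s => f₁ (Γ.path e s) - f₂ (Γ.path e s)) (Iic t) t =
        derivWithin (fun s => f₁ (Γ.path e s)) (Iic t) t -
          derivWithin (fun s => f₂ (Γ.path e s)) (Iic t) t := fun e t ht =>
    derivWithin_fun_sub (h₁.differentiableWithinAt_left ht) (h₂.differentiableWithinAt_left ht)
  cases x with
  | vertex a =>
    simp only [slopeSum]
    simp only [hr _ 0 ⟨le_rfl, Γ.len_pos _⟩, hl _ _ ⟨Γ.len_pos _, le_rfl⟩]
    rw [add_sub_add_comm, ← Finset.sum_sub_distrib, ← Finset.sum_sub_distrib]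
    congr 1 <;> refine Finset.sum_congr rfl fun e _ => ?_ <;> split_ifs <;> ring
  | inner e t =>
    simp only [slopeSum]
    rw [hr e t ⟨t.2.1.le, t.2.2⟩, hl e t ⟨t.2.1, t.2.2.le⟩]
    ring

-- Turns the slopes at a vertex into the discrete Laplacian. The corrections ρ and σ leave room for
-- the slopes of the bump functions at the ends of the edges.
open scoped Classical in
theorem sum_slopes_eq (F : Γ.V → ℝ) (ρ σ : Γ.E → ℝ) (a : Γ.V) :
    (∑ e : Γ.E, if Γ.src e = a then (F (Γ.tgt e) - F (Γ.src e)) / Γ.len e + ρ e else 0) +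
      (∑ e : Γ.E, if Γ.tgt e = a then -((F (Γ.tgt e) - F (Γ.src e)) / Γ.len e + σ e) else 0) =
    -Γ.energy F (fun v => if v = a then 1 else 0) +
      ∑ e : Γ.E, ((if Γ.src e = a then ρ e else 0) - if Γ.tgt e = a then σ e else 0) := by
  simp only [energy, ← Finset.sum_add_distrib, ← Finset.sum_neg_distrib]
  refine Finset.sum_congr rfl fun e _ => ?_
  split_ifs <;> ring

/-- Harmonic functions are constant. Inside an edge the two one-sided slopes agree, so f is affine
on the whole edge; at the vertices the discrete Laplacian is then zero, so the energy is zero. This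
gives uniqueness of the voltage function. -/
theorem IsPiecewiseAffine.eq_const (hΓ : Γ.Rigid) (hf : Γ.IsPiecewiseAffine f)
    (h : ∀ x, Γ.slopeSum f x = 0) (x y : Γ.Point) : f x = f y := by
  classical
  have hlin : ∀ e, ∀ t ∈ Icc 0 (Γ.len e),
      f (Γ.path e t) = Γ.lin e (fun v => f (.vertex v)) t := by
    intro e
    have hc : Continuous fun s => f (Γ.path e s) := hf.1.comp (continuous_path e)
    have hloc : ∀ t ∈ Ioo 0 (Γ.len e), ∃ a b : ℝ, ∀ᶠ s in 𝓝 t, f (Γ.path e s) = a + b * s := by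
      intro t ht
      obtain ⟨a, b, hab⟩ := hf.exists_right ⟨ht.1.le, ht.2⟩
      obtain ⟨a', b', hab'⟩ := hf.exists_left ⟨ht.1, ht.2.le⟩
      have h1 := (hasDerivWithinAt_affine self_mem_Ici hab).derivWithin
        (uniqueDiffOn_Ici t t self_mem_Ici)
      have h2 := (hasDerivWithinAt_affine self_mem_Iic hab').derivWithin
        (uniqueDiffOn_Iic t t self_mem_Iic)
      have h3 := h (.inner e ⟨t, ht⟩)
      simp only [slopeSum, h1, h2] at h3
      have h4 := hab.self_of_nhdsWithin self_mem_Ici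
      have h5 := hab'.self_of_nhdsWithin self_mem_Iic
      obtain rfl : b' = b := by linarith
      obtain rfl : a' = a := by linarith
      refine ⟨a', b', ?_⟩
      rw [← nhdsLE_sup_nhdsGE]
      exact eventually_sup.2 ⟨hab', hab⟩
    obtain ⟨a, b, hab⟩ := exists_affine_of_locally_affine hloc
    have hcl : EqOn (fun s => f (Γ.path e s)) (fun s => a + b * s) (Icc 0 (Γ.len e)) := by
      have : EqOn (fun s => f (Γ.path e s)) (fun s => a + b * s) (Ioo 0 (Γ.len e)) := hab
      rw [← closure_Ioo (Γ.len_pos e).ne]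
      exact this.closure hc (by fun_prop)
    intro t ht
    have h0 := hcl ⟨le_rfl, (Γ.len_pos e).le⟩
    have h1 := hcl ⟨(Γ.len_pos e).le, le_rfl⟩
    have h2 := hcl ht
    simp only [path_zero, path_len] at h0 h1 h2
    have := (Γ.len_pos e).ne'
    rw [h2, lin, h0, h1]
    field_simp
    ring
  have hv : ∀ a b, f (.vertex a) = f (.vertex b) := by
    refine hΓ.eq_of_forall_energy_single (f := fun v => f (.vertex v)) fun a => ?_
    have h1 := h (.vertex a)
    have h2 : ∀ e, derivWithin (fun s => f (Γ.path e s)) (Ici 0) 0 =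
        (f (.vertex (Γ.tgt e)) - f (.vertex (Γ.src e))) / Γ.len e + 0 := fun e => by
      rw [add_zero]
      refine (hasDerivWithinAt_affine (a := f (.vertex (Γ.src e))) self_mem_Ici ?_).derivWithin
        (uniqueDiffOn_Ici _ _ self_mem_Ici)
      filter_upwards [Icc_mem_nhdsGE (Γ.len_pos e)] with s hs using hlin e s hs
    have h3 : ∀ e, derivWithin (fun s => f (Γ.path e s)) (Iic (Γ.len e)) (Γ.len e) =
        (f (.vertex (Γ.tgt e)) - f (.vertex (Γ.src e))) / Γ.len e + 0 := fun e => by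
      rw [add_zero]
      refine (hasDerivWithinAt_affine (a := f (.vertex (Γ.src e))) self_mem_Iic ?_).derivWithin
        (uniqueDiffOn_Iic _ _ self_mem_Iic)
      filter_upwards [Icc_mem_nhdsLE (Γ.len_pos e)] with s hs using hlin e s hs
    simp only [slopeSum, h2, h3] at h1
    rw [sum_slopes_eq (fun v => f (.vertex v)) (fun _ => 0) (fun _ => 0)] at h1
    simpa using h1
  have hx : ∀ x : Γ.Point, ∃ a, f x = f (.vertex a) := by
    intro x
    cases x with
    | vertex a => exact ⟨a, rfl⟩
    | inner e t =>
      refine ⟨Γ.src e, ?_⟩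
      have := hlin e t ⟨t.2.1.le, t.2.2.le⟩
      rw [path_of_mem t.2, lin, hv (Γ.tgt e) (Γ.src e)] at this
      simpa using this
  obtain ⟨a, ha⟩ := hx x
  obtain ⟨b, hb⟩ := hx y
  rw [ha, hb, hv a b]

theorem IsVoltage.unique (hΓ : Γ.Rigid) {z y : Γ.Point} (h₁ : Γ.IsVoltage z y f₁)
    (h₂ : Γ.IsVoltage z y f₂) : f₁ = f₂ := by
  ext x
  have := (h₁.1.sub h₂.1).eq_const hΓ (fun x => by
    have e₁ := h₁.2.1 x
    have e₂ := h₂.2.1 x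
    rw [laplacianMass] at e₁ e₂
    rw [h₁.1.slopeSum_sub h₂.1]
    linarith) x z
  rw [h₁.2.2, h₂.2.2] at this
  linarith

theorem IsVoltage.voltage_eq (hΓ : Γ.Rigid) {z y : Γ.Point} (h : Γ.IsVoltage z y f)
    (x : Γ.Point) : Γ.voltage z x y = f x := by
  have hex : ∃ f, Γ.IsVoltage z y f := ⟨f, h⟩
  rw [voltage, dif_pos hex, hex.choose_spec.unique hΓ h]

end PiecewiseAffine

/-! ### The voltage function in terms of the Green function -/

section Voltage

variable {Γ : MetrizedGraph.{u, v}} {o : Γ.V} {g : Γ.V → Γ.V → ℝ}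

theorem isPiecewiseAffine_green (g : Γ.V → Γ.V → ℝ) (y : Γ.Point) :
    Γ.IsPiecewiseAffine fun x => Γ.green g x y := by
  -- The bump function has its only kink at y.
  refine ⟨continuous_green g y, {y}, finite_singleton y, fun e t ht hty => ?_⟩
  set F : Γ.V → ℝ := fun v => Γ.interp (g v) y with hF
  set m := (F (Γ.tgt e) - F (Γ.src e)) / Γ.len e with hm
  have hev : ∀ᶠ s in 𝓝 t, Γ.green g (Γ.path e s) y = F (Γ.src e) + m * s + Γ.bump e y s := by
    filter_upwards [Icc_mem_nhds ht.1 ht.2] with s hs using green_path g y hs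
  cases y with
  | vertex a => exact ⟨F (Γ.src e), m, hev.mono fun s hs => hs.trans (by simp [bump])⟩
  | inner f u =>
    by_cases h : f = e
    · subst h
      have htu : t ≠ u := fun h => hty (by rw [h, path_of_mem u.2]; rfl)
      rcases htu.lt_or_gt with h | h
      · refine ⟨F (Γ.src f), m + 1 - u / Γ.len f, ?_⟩
        filter_upwards [hev, Iio_mem_nhds h] with s hs hsu
        simp only [hs, bump, if_true, min_eq_left (mem_Iio.1 hsu).le]
        ring
      · refine ⟨F (Γ.src f) + u, m - u / Γ.len f, ?_⟩
        filter_upwards [hev, Ioi_mem_nhds h] with s hs hsu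
        simp only [hs, bump, if_true, min_eq_right (mem_Ioi.1 hsu).le]
        ring
    · exact ⟨F (Γ.src e), m, hev.mono fun s hs => hs.trans (by simp [bump, h])⟩

open scoped Classical in
/-- The right derivative of `bump e y`. -/
def bumpRight (Γ : MetrizedGraph.{u, v}) (e : Γ.E) : Γ.Point → ℝ → ℝ
  | .vertex _, _ => 0
  | .inner f u, s => if f = e then (if s < u then 1 else 0) - u / Γ.len e else 0

open scoped Classical in
/-- The left derivative of `bump e y`. -/
def bumpLeft (Γ : MetrizedGraph.{u, v}) (e : Γ.E) : Γ.Point → ℝ → ℝ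
  | .vertex _, _ => 0
  | .inner f u, s => if f = e then (if s ≤ u then 1 else 0) - u / Γ.len e else 0

theorem derivWithin_green_right {e : Γ.E} (y : Γ.Point) {t : ℝ} (ht : t ∈ Ico 0 (Γ.len e)) :
    derivWithin (fun s => Γ.green g (Γ.path e s) y) (Ici t) t =
      (Γ.interp (g (Γ.tgt e)) y - Γ.interp (g (Γ.src e)) y) / Γ.len e + Γ.bumpRight e y t := by
  set F : Γ.V → ℝ := fun v => Γ.interp (g v) y with hF
  set m := (F (Γ.tgt e) - F (Γ.src e)) / Γ.len e with hm
  have hev : ∀ᶠ s in 𝓝[≥] t,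
      Γ.green g (Γ.path e s) y = F (Γ.src e) + m * s + Γ.bump e y s := by
    filter_upwards [Ico_mem_nhdsGE ht.2] with s hs
    exact green_path g y ⟨ht.1.trans hs.1, hs.2.le⟩
  suffices h : ∃ a, ∀ᶠ s in 𝓝[≥] t,
      Γ.green g (Γ.path e s) y = a + (m + Γ.bumpRight e y t) * s by
    obtain ⟨a, ha⟩ := h
    exact (hasDerivWithinAt_affine self_mem_Ici ha).derivWithin
      (uniqueDiffOn_Ici t t self_mem_Ici)
  cases y with
  | vertex a => exact ⟨F (Γ.src e), hev.mono fun s hs => by rw [hs]; simp [bump, bumpRight]⟩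
  | inner f u =>
    by_cases h : f = e
    · subst h
      rcases lt_or_ge t u with h | h
      · refine ⟨F (Γ.src f), ?_⟩
        filter_upwards [hev, mem_nhdsWithin_of_mem_nhds (Iio_mem_nhds h)] with s hs hsu
        simp only [hs, bump, bumpRight, if_true, min_eq_left (mem_Iio.1 hsu).le, h]
        ring
      · refine ⟨F (Γ.src f) + u, ?_⟩
        filter_upwards [hev, self_mem_nhdsWithin] with s hs hsu
        simp only [hs, bump, bumpRight, if_true, min_eq_right (h.trans (mem_Ici.1 hsu)), h.not_gt,
          if_false]
        ring
    · exact ⟨F (Γ.src e), hev.mono fun s hs => by rw [hs]; simp [bump, bumpRight, h]⟩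

theorem derivWithin_green_left {e : Γ.E} (y : Γ.Point) {t : ℝ} (ht : t ∈ Ioc 0 (Γ.len e)) :
    derivWithin (fun s => Γ.green g (Γ.path e s) y) (Iic t) t =
      (Γ.interp (g (Γ.tgt e)) y - Γ.interp (g (Γ.src e)) y) / Γ.len e + Γ.bumpLeft e y t := by
  set F : Γ.V → ℝ := fun v => Γ.interp (g v) y with hF
  set m := (F (Γ.tgt e) - F (Γ.src e)) / Γ.len e with hm
  have hev : ∀ᶠ s in 𝓝[≤] t,
      Γ.green g (Γ.path e s) y = F (Γ.src e) + m * s + Γ.bump e y s := by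
    filter_upwards [Ioc_mem_nhdsLE ht.1] with s hs
    exact green_path g y ⟨hs.1.le, hs.2.trans ht.2⟩
  suffices h : ∃ a, ∀ᶠ s in 𝓝[≤] t,
      Γ.green g (Γ.path e s) y = a + (m + Γ.bumpLeft e y t) * s by
    obtain ⟨a, ha⟩ := h
    exact (hasDerivWithinAt_affine self_mem_Iic ha).derivWithin
      (uniqueDiffOn_Iic t t self_mem_Iic)
  cases y with
  | vertex a => exact ⟨F (Γ.src e), hev.mono fun s hs => by rw [hs]; simp [bump, bumpLeft]⟩
  | inner f u =>
    by_cases h : f = e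
    · subst h
      rcases le_or_gt t u with h | h
      · refine ⟨F (Γ.src f), ?_⟩
        filter_upwards [hev, self_mem_nhdsWithin] with s hs hsu
        simp only [hs, bump, bumpLeft, if_true, min_eq_left ((mem_Iic.1 hsu).trans h), h]
        ring
      · refine ⟨F (Γ.src f) + u, ?_⟩
        filter_upwards [hev, mem_nhdsWithin_of_mem_nhds (Ioi_mem_nhds h)] with s hs hsu
        simp only [hs, bump, bumpLeft, if_true, min_eq_right (mem_Ioi.1 hsu).le, h.not_ge,
          if_false]
        ring
    · exact ⟨F (Γ.src e), hev.mono fun s hs => by rw [hs]; simp [bump, bumpLeft, h]⟩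

/-- Both sides are affine in y along an edge, so the case of vertices suffices. -/
theorem IsGreen.energy_interp (hg : Γ.IsGreen o g) (y : Γ.Point) (φ : Γ.V → ℝ) :
    Γ.energy (fun v => Γ.interp (g v) y) φ = Γ.interp φ y - φ o := by
  cases y with
  | vertex a => exact hg.energy_eq a φ
  | inner e t =>
    have h : (fun v => Γ.interp (g v) (.inner e t)) = fun v => g v (Γ.src e) -
        (-((t : ℝ) / Γ.len e)) * (g v (Γ.tgt e) - g v (Γ.src e)) := by
      ext v
      simp only [interp, lin]
      ring
    rw [h, energy_sub_mul_left, energy_sub_left, hg.energy_eq, hg.energy_eq]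
    simp only [interp, lin]
    ring

-- For y at parameter u of an edge of length L, the interpolated part spreads the unit source over
-- the two ends with weights 1 - u/L and u/L. The end slopes of the bump function cancel these
-- weights, and its kink puts the source at y.
open scoped Classical in
theorem IsGreen.slopeSum_green (hg : Γ.IsGreen o g) (y x : Γ.Point) :
    Γ.slopeSum (fun x => Γ.green g x y) x =
      (if x = .vertex o then 1 else 0) - (if x = y then 1 else 0) := by
  cases x with
  | vertex a =>
    simp only [slopeSum, derivWithin_green_right y ⟨le_rfl, Γ.len_pos _⟩,
      derivWithin_green_left y ⟨Γ.len_pos _, le_rfl⟩]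
    have h1 := sum_slopes_eq (fun v => Γ.interp (g v) y) (fun e => Γ.bumpRight e y 0)
      (fun e => Γ.bumpLeft e y (Γ.len e)) a
    rw [hg.energy_interp] at h1
    refine h1.trans ?_
    cases y with
    | vertex b => simp [bumpRight, bumpLeft, interp, eq_comm]
    | inner f u =>
      have h2 : ∀ e, ((if Γ.src e = a then Γ.bumpRight e (.inner f u) 0 else 0) -
          if Γ.tgt e = a then Γ.bumpLeft e (.inner f u) (Γ.len e) else 0) =
          if f = e then (if Γ.src e = a then 1 - u / Γ.len e else 0) +
            (if Γ.tgt e = a then u / Γ.len e else 0) else 0 := by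
        intro e
        by_cases h : f = e
        · subst h
          have h0 : (0 : ℝ) < u := u.2.1
          have hL : ¬ Γ.len f ≤ u := not_le.2 u.2.2
          simp only [bumpRight, bumpLeft, if_true, h0, hL, if_false]
          split_ifs <;> ring
        · simp [bumpRight, bumpLeft, h]
      rw [Finset.sum_congr rfl fun e _ => h2 e, Finset.sum_ite_eq, if_pos (Finset.mem_univ _)]
      simp only [interp, lin, reduceCtorEq, if_false, Point.vertex.injEq, eq_comm (a := o)]
      split_ifs <;> ring
  | inner e t =>
    simp only [slopeSum]
    rw [derivWithin_green_right y ⟨t.2.1.le, t.2.2⟩, derivWithin_green_left y ⟨t.2.1, t.2.2.le⟩]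
    cases y with
    | vertex b => simp [bumpRight, bumpLeft]
    | inner f u =>
      by_cases h : f = e
      · subst h
        by_cases htu : t = u
        · subst htu
          simp [bumpRight, bumpLeft]
          ring
        · have hne : (t : ℝ) ≠ u := fun h => htu (Subtype.ext h)
          rcases hne.lt_or_gt with h | h
          · simp [bumpRight, bumpLeft, h, h.le, htu]
            ring
          · simp [bumpRight, bumpLeft, h.not_ge, h.not_gt, htu]
      · have : Point.inner e t ≠ Point.inner f u := fun h' => h (Point.inner.inj h').1.symm
        simp [bumpRight, bumpLeft, h, this]

theorem IsGreen.isVoltage (hg : Γ.IsGreen o g) (z y : Γ.Point) :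
    Γ.IsVoltage z y fun x =>
      Γ.green g x y - Γ.green g x z - (Γ.green g z y - Γ.green g z z) := by
  have hy := isPiecewiseAffine_green g y
  have hz := isPiecewiseAffine_green g z
  refine ⟨(hy.sub hz).sub (isPiecewiseAffine_const _), fun x => ?_, by ring⟩
  rw [laplacianMass, (hy.sub hz).slopeSum_sub (isPiecewiseAffine_const _), hy.slopeSum_sub hz,
    hg.slopeSum_green, hg.slopeSum_green, slopeSum_const]
  ring

theorem IsGreen.voltage_eq (hg : Γ.IsGreen o g) (hΓ : Γ.Rigid) (z x y : Γ.Point) :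
    Γ.voltage z x y = Γ.green g x y - Γ.green g x z - (Γ.green g z y - Γ.green g z z) :=
  (hg.isVoltage z y).voltage_eq hΓ x

theorem IsGreen.resistance_eq (hg : Γ.IsGreen o g) (hΓ : Γ.Rigid) (x y : Γ.Point) :
    Γ.resistance x y = Γ.green g x x + Γ.green g y y - 2 * Γ.green g x y := by
  rw [resistance, hg.voltage_eq hΓ, green_symm hg.symm y x]
  ring

theorem IsGreen.green_root (hg : Γ.IsGreen o g) (x : Γ.Point) : Γ.green g (.vertex o) x = 0 := by
  cases x <;> simp [green, interp, lin, hg.root]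

end Voltage

/-! ### Integration against signed measures -/

section SignedMeasure

variable {X : Type*} [MeasurableSpace X]

theorem vectorMeasure_integrable_toSignedMeasure {ν : Measure X} [IsFiniteMeasure ν] {f : X → ℝ}
    (hf : Integrable f ν) : ν.toSignedMeasure.Integrable f := by
  rw [VectorMeasure.Integrable, Measure.variation_toSignedMeasure]
  exact hf

theorem vectorMeasure_integrable_signedMeasure (μ : SignedMeasure X) {f : X → ℝ}
    (hf : ∀ (ν : Measure X) [IsFiniteMeasure ν], Integrable f ν) : μ.Integrable f := by
  rw [← SignedMeasure.toSignedMeasure_toJordanDecomposition μ, JordanDecomposition.toSignedMeasure]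
  exact (vectorMeasure_integrable_toSignedMeasure (hf _)).sub_vectorMeasure
    (vectorMeasure_integrable_toSignedMeasure (hf _))

theorem integral_signedMeasure (μ : SignedMeasure X) {f : X → ℝ}
    (hf₁ : Integrable f μ.toJordanDecomposition.posPart)
    (hf₂ : Integrable f μ.toJordanDecomposition.negPart) :
    ∫ᵛ x, f x ∂<•μ = ∫ x, f x ∂μ.toJordanDecomposition.posPart -
      ∫ x, f x ∂μ.toJordanDecomposition.negPart := by
  conv_lhs => rw [← SignedMeasure.toSignedMeasure_toJordanDecomposition μ,
    JordanDecomposition.toSignedMeasure]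
  rw [VectorMeasure.integral_sub_vectorMeasure (vectorMeasure_integrable_toSignedMeasure hf₁)
    (vectorMeasure_integrable_toSignedMeasure hf₂), VectorMeasure.integral_toSignedMeasure,
    VectorMeasure.integral_toSignedMeasure]

theorem integral_signedMeasure_const (μ : SignedMeasure X) (c : ℝ) :
    ∫ᵛ _x, c ∂<•μ = c * μ univ := by
  rw [integral_signedMeasure μ (integrable_const c) (integrable_const c), integral_const,
    integral_const]
  conv_rhs => rw [← SignedMeasure.toSignedMeasure_toJordanDecomposition μ,
    JordanDecomposition.toSignedMeasure]
  rw [sub_apply, Measure.toSignedMeasure_apply_measurable .univ,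
    Measure.toSignedMeasure_apply_measurable .univ]
  simp only [smul_eq_mul]
  ring

/-- Continuity in t and measurability in x already give joint measurability, so Fubini applies
without any topology on X. -/
theorem integrable_uncurry_of_bound {K : ℝ → X → ℝ} {C : ℝ} (L : ℝ)
    (hc : ∀ x, Continuous fun t => K t x) (hm : ∀ t, Measurable (K t))
    (hC : ∀ t x, |K t x| ≤ C) (ν : Measure X) [IsFiniteMeasure ν] :
    Integrable (Function.uncurry K) ((volume.restrict (Ioc 0 L)).prod ν) :=
  .of_bound (measurable_uncurry_of_continuous_of_measurable hc hm).aestronglyMeasurable C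
    (.of_forall fun p => hC p.1 p.2)

theorem integrable_intervalIntegral_signedMeasure (μ : SignedMeasure X) {K : ℝ → X → ℝ} {C L : ℝ}
    (hL : 0 ≤ L) (hc : ∀ x, Continuous fun t => K t x) (hm : ∀ t, Measurable (K t))
    (hC : ∀ t x, |K t x| ≤ C) : μ.Integrable fun x => ∫ t in (0 : ℝ)..L, K t x := by
  simp only [intervalIntegral.integral_of_le hL]
  exact vectorMeasure_integrable_signedMeasure μ fun ν _ =>
    (integrable_uncurry_of_bound L hc hm hC ν).integral_prod_right

theorem intervalIntegral_integral_signedMeasure (μ : SignedMeasure X) {K : ℝ → X → ℝ} {C L : ℝ}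
    (hL : 0 ≤ L) (hc : ∀ x, Continuous fun t => K t x) (hm : ∀ t, Measurable (K t))
    (hC : ∀ t x, |K t x| ≤ C) :
    ∫ t in (0 : ℝ)..L, ∫ᵛ x, K t x ∂<•μ = ∫ᵛ x, (∫ t in (0 : ℝ)..L, K t x) ∂<•μ := by
  have h1 : ∀ (ν : Measure X) [IsFiniteMeasure ν] (t : ℝ), Integrable (K t) ν := fun ν _ t =>
    .of_bound (hm t).aestronglyMeasurable C (.of_forall (hC t))
  have h2 := fun (ν : Measure X) [IsFiniteMeasure ν] => integrable_uncurry_of_bound L hc hm hC ν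
  have h3 : ∀ (ν : Measure X) [IsFiniteMeasure ν],
      Integrable (fun x => ∫ t in Ioc 0 L, K t x) ν := fun ν _ => (h2 ν).integral_prod_right
  have h4 : ∀ (ν : Measure X) [IsFiniteMeasure ν],
      Integrable (fun t => ∫ x, K t x ∂ν) (volume.restrict (Ioc 0 L)) := fun ν _ =>
    (h2 ν).integral_prod_left
  simp only [intervalIntegral.integral_of_le hL]
  rw [integral_signedMeasure μ (h3 _) (h3 _), ← integral_integral_swap (h2 _),
    ← integral_integral_swap (h2 _), ← integral_sub (h4 _) (h4 _)]
  exact integral_congr_ae (.of_forall fun t => integral_signedMeasure μ (h1 _ t) (h1 _ t))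

end SignedMeasure

/-! ### Boundedness of the extended Green function, and its restriction to the diagonal. -/

section Bounds

variable {Γ : MetrizedGraph.{u, v}} {o : Γ.V} {g : Γ.V → Γ.V → ℝ}

/-- Treats vertices and interior points uniformly: linearity and bounds for `interp` follow at once.
-/
theorem exists_interp_eq (x : Γ.Point) : ∃ (a b : Γ.V) (θ : ℝ), θ ∈ Icc 0 1 ∧
    ∀ F : Γ.V → ℝ, Γ.interp F x = (1 - θ) * F a + θ * F b := by
  cases x with
  | vertex a => exact ⟨a, a, 0, by simp, fun F => by simp [interp]⟩
  | inner e t =>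
    have h := (Γ.len_pos e).le
    refine ⟨Γ.src e, Γ.tgt e, t / Γ.len e, ⟨div_nonneg t.2.1.le h, div_le_one_of_le₀ t.2.2.le h⟩,
      fun F => ?_⟩
    simp only [interp, lin]
    ring

theorem abs_interp_le (F : Γ.V → ℝ) (x : Γ.Point) : |Γ.interp F x| ≤ ∑ a, |F a| := by
  obtain ⟨a, b, θ, hθ, h⟩ := exists_interp_eq x
  have h1 : ∀ a, |F a| ≤ ∑ a, |F a| := fun a =>
    Finset.single_le_sum (f := fun a => |F a|) (fun i _ => abs_nonneg _) (Finset.mem_univ a)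
  rw [h]
  calc |(1 - θ) * F a + θ * F b| ≤ |(1 - θ) * F a| + |θ * F b| := abs_add_le _ _
    _ = (1 - θ) * |F a| + θ * |F b| := by
      rw [abs_mul, abs_mul, abs_of_nonneg hθ.1, abs_of_nonneg (sub_nonneg.2 hθ.2)]
    _ ≤ (1 - θ) * ∑ a, |F a| + θ * ∑ a, |F a| :=
      add_le_add (mul_le_mul_of_nonneg_left (h1 a) (sub_nonneg.2 hθ.2))
        (mul_le_mul_of_nonneg_left (h1 b) hθ.1)
    _ = ∑ a, |F a| := by ring

theorem abs_bump_le {e : Γ.E} (y : Γ.Point) {s : ℝ} (hs : s ∈ Icc 0 (Γ.len e)) :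
    |Γ.bump e y s| ≤ Γ.len e := by
  have hL := Γ.len_pos e
  cases y with
  | vertex a => simpa [bump] using hL.le
  | inner f u =>
    by_cases h : f = e
    · subst h
      have hu := u.2.1
      have h1 : s * u / Γ.len f ≤ u := by
        rw [div_le_iff₀ hL, mul_comm]
        exact mul_le_mul_of_nonneg_left hs.2 hu.le
      have h2 : 0 ≤ s * u / Γ.len f := div_nonneg (mul_nonneg hs.1 hu.le) hL.le
      have h3 := u.2.2
      have h4 : min s u ≤ (u : ℝ) := min_le_right _ _
      have h5 : 0 ≤ min s u := le_min hs.1 hu.le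
      simp only [bump, if_true, abs_le]
      constructor <;> linarith
    · simpa [bump, h] using hL.le

theorem exists_abs_green_le (g : Γ.V → Γ.V → ℝ) : ∃ C, ∀ x y, |Γ.green g x y| ≤ C := by
  refine ⟨∑ a, (∑ b, |g a b|) + ∑ e, Γ.len e, fun x y => ?_⟩
  have h : |Γ.green g x y - Γ.interp (fun v => Γ.interp (g v) y) x| ≤ ∑ e, Γ.len e := by
    have h0 : ∀ e, 0 ≤ Γ.len e := fun e => (Γ.len_pos e).le
    cases x with
    | vertex a => simpa [green, interp] using Finset.sum_nonneg fun e _ => h0 e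
    | inner e s =>
      simp only [green, interp, add_sub_cancel_left]
      exact (abs_bump_le y ⟨s.2.1.le, s.2.2.le⟩).trans
        (Finset.single_le_sum (f := Γ.len) (fun e _ => h0 e) (Finset.mem_univ e))
  calc |Γ.green g x y| ≤ |Γ.interp (fun v => Γ.interp (g v) y) x| +
        |Γ.green g x y - Γ.interp (fun v => Γ.interp (g v) y) x| := by
        simpa using abs_add_le (Γ.interp (fun v => Γ.interp (g v) y) x)
          (Γ.green g x y - Γ.interp (fun v => Γ.interp (g v) y) x)
    _ ≤ ∑ a, (∑ b, |g a b|) + ∑ e, Γ.len e :=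
        add_le_add ((abs_interp_le _ x).trans
          (Finset.sum_le_sum fun a _ => abs_interp_le (g a) y)) h

theorem IsGreen.green_self_path (hg : Γ.IsGreen o g) {e : Γ.E} {s : ℝ}
    (hs : s ∈ Icc 0 (Γ.len e)) :
    Γ.green g (Γ.path e s) (Γ.path e s) =
      Γ.lin e (fun v => g v v) s + (1 - Γ.foster g e) * (s - s ^ 2 / Γ.len e) := by
  have hL := (Γ.len_pos e).ne'
  have hb : Γ.bump e (Γ.path e s) s = s - s ^ 2 / Γ.len e := by
    rcases mem_Icc_cases hs with rfl | rfl | h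
    · simp
    · rw [bump_len]
      field_simp
      ring
    · rw [path_of_mem h]
      simp [bump, sq]
  rw [green_path g _ hs, hb]
  simp only [interp_path _ hs, lin, foster, hg.symm (Γ.tgt e) (Γ.src e)]
  field_simp
  ring

theorem IsGreen.continuous_green_self (hg : Γ.IsGreen o g) :
    Continuous fun x => Γ.green g x x :=
  continuous_of_eqOn_path (fun e => by simp only [lin]; fun_prop)
    fun e t ht => hg.green_self_path ht

end Bounds

/-! ### The canonical measure -/

/-- The canonical measure: `1 - val / 2` at the vertices, and the density `1 / (L + R)` on each
edge, where `R` is the effective resistance between the end points in the rest of the graph. -/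
def canonicalMeasure (Γ : MetrizedGraph.{u, v}) (g : Γ.V → Γ.V → ℝ) : SignedMeasure Γ.Point :=
  (∑ a : Γ.V, (Measure.dirac (Point.vertex a)).toSignedMeasure) +
    ∑ e : Γ.E, (((1 - Γ.foster g e) / Γ.len e) •
        (Measure.map (Γ.path e) (volume.restrict (Ioc 0 (Γ.len e)))).toSignedMeasure +
      (-(1 / 2 : ℝ)) • ((Measure.dirac (Point.vertex (Γ.src e))).toSignedMeasure +
        (Measure.dirac (Point.vertex (Γ.tgt e))).toSignedMeasure))

section Canonical

variable {Γ : MetrizedGraph.{u, v}} {o : Γ.V} {g : Γ.V → Γ.V → ℝ}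

theorem integrable_of_continuous_point {f : Γ.Point → ℝ} (hf : Continuous f)
    (ν : Measure Γ.Point) [IsFiniteMeasure ν] : Integrable f ν := by
  obtain ⟨C, hC⟩ := isCompact_univ.exists_bound_of_continuousOn hf.continuousOn
  exact .of_bound hf.measurable.aestronglyMeasurable C (.of_forall fun x => hC x (mem_univ x))

theorem integral_canonicalMeasure (g : Γ.V → Γ.V → ℝ) {f : Γ.Point → ℝ} (hf : Continuous f) :
    ∫ᵛ x, f x ∂<•(Γ.canonicalMeasure g) = (∑ a, f (.vertex a)) +
      ∑ e, ((1 - Γ.foster g e) / Γ.len e * (∫ t in (0 : ℝ)..Γ.len e, f (Γ.path e t)) -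
        (f (.vertex (Γ.src e)) + f (.vertex (Γ.tgt e))) / 2) := by
  have hi : ∀ (ν : Measure Γ.Point) [IsFiniteMeasure ν], ν.toSignedMeasure.Integrable f :=
    fun ν _ => vectorMeasure_integrable_toSignedMeasure (integrable_of_continuous_point hf ν)
  have hd : ∀ a, ∫ x, f x ∂(Measure.dirac (Point.vertex a)) = f (.vertex a) := fun a =>
    integral_dirac' f _ hf.measurable.stronglyMeasurable
  have he : ∀ e, (((1 - Γ.foster g e) / Γ.len e) •
      (Measure.map (Γ.path e) (volume.restrict (Ioc 0 (Γ.len e)))).toSignedMeasure).Integrable f :=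
    fun e => (hi _).smul_vectorMeasure _
  have hv : ∀ e, ((-(1 / 2 : ℝ)) • ((Measure.dirac (Point.vertex (Γ.src e))).toSignedMeasure +
      (Measure.dirac (Point.vertex (Γ.tgt e))).toSignedMeasure)).Integrable f :=
    fun e => ((hi _).add_vectorMeasure (hi _)).smul_vectorMeasure _
  rw [canonicalMeasure, VectorMeasure.integral_add_vectorMeasure
    (.finsetSum_vectorMeasure fun a _ => hi _)
    (.finsetSum_vectorMeasure fun e _ => (he e).add_vectorMeasure (hv e)),
    VectorMeasure.integral_finsetSum_vectorMeasure fun a _ => hi _,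
    VectorMeasure.integral_finsetSum_vectorMeasure fun e _ => (he e).add_vectorMeasure (hv e)]
  congr 1
  · exact Finset.sum_congr rfl fun a _ => by rw [VectorMeasure.integral_toSignedMeasure, hd]
  · refine Finset.sum_congr rfl fun e _ => ?_
    rw [VectorMeasure.integral_add_vectorMeasure (he e) (hv e),
      VectorMeasure.integral_smul_vectorMeasure, VectorMeasure.integral_smul_vectorMeasure,
      VectorMeasure.integral_add_vectorMeasure (hi _) (hi _),
      VectorMeasure.integral_toSignedMeasure, VectorMeasure.integral_toSignedMeasure,
      VectorMeasure.integral_toSignedMeasure, hd, hd,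
      integral_map (continuous_path e).measurable.aemeasurable
        hf.measurable.aestronglyMeasurable, intervalIntegral.integral_of_le (Γ.len_pos e).le]
    simp only [smul_eq_mul]
    ring

/-- The Laplacian of `v ↦ g (v, v)`, in weak form. -/
theorem IsGreen.energy_diag (hg : Γ.IsGreen o g) (φ : Γ.V → ℝ) :
    Γ.energy (fun v => g v v) φ =
      2 * ∑ a, φ a - 2 * φ o - ∑ e, Γ.foster g e * (φ (Γ.src e) + φ (Γ.tgt e)) := by
  classical
  -- The same weighted sum of masses is computed twice, by the Green property and by regrouping over
  -- the edges. On each edge, polarization splits it into the increment of the diagonal and a Foster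
  -- term.
  have h1 : ∑ a, φ a * Γ.energy (fun x => g x a) (fun x => if x = a then 1 else 0) =
      ∑ a, φ a - φ o := by
    simp only [hg.energy_eq, mul_sub, Finset.sum_sub_distrib]
    simp
  have h2 : ∑ a, φ a * Γ.energy (fun x => g x a) (fun x => if x = a then 1 else 0) =
      1 / 2 * Γ.energy (fun v => g v v) φ +
        1 / 2 * ∑ e, Γ.foster g e * (φ (Γ.src e) + φ (Γ.tgt e)) := by
    simp only [energy, Finset.mul_sum, ← Finset.sum_add_distrib]
    rw [Finset.sum_comm]
    refine Finset.sum_congr rfl fun e _ => ?_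
    have h3 : ∀ a, φ a * ((g (Γ.tgt e) a - g (Γ.src e) a) *
        ((if Γ.tgt e = a then 1 else 0) - if Γ.src e = a then 1 else 0) / Γ.len e) =
        (if Γ.tgt e = a then φ a * (g (Γ.tgt e) a - g (Γ.src e) a) / Γ.len e else 0) -
        (if Γ.src e = a then φ a * (g (Γ.tgt e) a - g (Γ.src e) a) / Γ.len e else 0) := by
      intro a
      split_ifs <;> ring
    simp only [h3, Finset.sum_sub_distrib, Finset.sum_ite_eq, Finset.mem_univ, if_true, foster,
      hg.symm (Γ.tgt e) (Γ.src e)]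
    have := (Γ.len_pos e).ne'
    field_simp
    ring
  linarith

/-- Foster's theorem. -/
theorem IsGreen.sum_foster (hg : Γ.IsGreen o g) :
    ∑ e, Γ.foster g e = Fintype.card Γ.V - 1 := by
  have h := hg.energy_diag fun _ => 1
  simp only [energy, sub_self, mul_zero, zero_div, Finset.sum_const_zero, Finset.sum_const,
    Finset.card_univ, nsmul_eq_mul, mul_one, ← Finset.sum_mul] at h
  linarith

/-- The mass is |V| + ∑ (1 - foster) - |E| = |V| - ∑ foster, so this is Foster's theorem. -/
theorem IsGreen.canonicalMeasure_univ (hg : Γ.IsGreen o g) : Γ.canonicalMeasure g univ = 1 := by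
  have h1 := integral_signedMeasure_const (Γ.canonicalMeasure g) 1
  have h3 : ∀ e, (1 - Γ.foster g e) / Γ.len e * Γ.len e = 1 - Γ.foster g e := fun e =>
    div_mul_cancel₀ _ (Γ.len_pos e).ne'
  rw [integral_canonicalMeasure g continuous_const] at h1
  simp only [intervalIntegral.integral_const, sub_zero, smul_eq_mul, mul_one, h3,
    Finset.sum_const, Finset.card_univ, nsmul_eq_mul, Finset.sum_sub_distrib, hg.sum_foster,
    one_mul] at h1
  linarith

theorem integral_quadratic (a b c l r : ℝ) :
    ∫ t in l..r, (a + b * t + c * t ^ 2) =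
      (a * r + b * r ^ 2 / 2 + c * r ^ 3 / 3) - (a * l + b * l ^ 2 / 2 + c * l ^ 3 / 3) := by
  refine intervalIntegral.integral_eq_sub_of_hasDerivAt
    (f := fun t => a * t + b * t ^ 2 / 2 + c * t ^ 3 / 3) (fun t _ => ?_)
    (Continuous.intervalIntegrable (by fun_prop) _ _)
  have h1 := (hasDerivAt_id' t).const_mul a
  have h2 := ((hasDerivAt_pow 2 t).const_mul b).div_const 2
  have h3 := ((hasDerivAt_pow 3 t).const_mul c).div_const 3
  convert (h1.fun_add h2).fun_add h3 using 1
  simp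
  ring

theorem integral_lin (e : Γ.E) (F : Γ.V → ℝ) :
    ∫ t in (0 : ℝ)..Γ.len e, Γ.lin e F t = Γ.len e * (F (Γ.src e) + F (Γ.tgt e)) / 2 := by
  have := (Γ.len_pos e).ne'
  have h := integral_quadratic (F (Γ.src e)) ((F (Γ.tgt e) - F (Γ.src e)) / Γ.len e) 0 0 (Γ.len e)
  simp only [zero_mul, add_zero] at h
  simp only [lin, h]
  field_simp
  ring

theorem continuous_lin (e : Γ.E) (F : Γ.V → ℝ) : Continuous (Γ.lin e F) := by
  unfold lin
  fun_prop

theorem continuous_bump (e : Γ.E) (x : Γ.Point) : Continuous (Γ.bump e x) := by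
  cases x with
  | vertex a => exact continuous_const
  | inner f u =>
    by_cases h : f = e
    · have : Γ.bump e (.inner f u) = fun s : ℝ => min s u - s * u / Γ.len e := by
        ext s; simp [bump, h]
      rw [this]; fun_prop
    · have : Γ.bump e (.inner f u) = fun _ => 0 := by
        ext s; simp [bump, h]
      rw [this]; exact continuous_const

open scoped Classical in
/-- The integral of `bump e x`. -/
def bumpInt (e : Γ.E) : Γ.Point → ℝ
  | .vertex _ => 0
  | .inner f u => if f = e then u * (Γ.len e - u) / 2 else 0

theorem integral_bump (e : Γ.E) (x : Γ.Point) :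
    ∫ t in (0 : ℝ)..Γ.len e, Γ.bump e x t = bumpInt e x := by
  cases x with
  | vertex a => simp [bump, bumpInt]
  | inner f u =>
    by_cases h : f = e
    · subst h
      have hL := (Γ.len_pos f).ne'
      have hc := continuous_bump f (.inner f u)
      have h0 := u.2.1.le
      have h1 := u.2.2.le
      rw [← intervalIntegral.integral_add_adjacent_intervals (b := (u : ℝ))
        (hc.intervalIntegrable _ _) (hc.intervalIntegrable _ _)]
      have e1 : ∫ t in (0 : ℝ)..u, Γ.bump f (.inner f u) t =
          ∫ t in (0 : ℝ)..u, (0 + (1 - u / Γ.len f) * t + 0 * t ^ 2) :=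
        intervalIntegral.integral_congr fun t ht => by
          rw [uIcc_of_le h0] at ht
          simp only [bump, if_true, min_eq_left ht.2]
          ring
      have e2 : ∫ t in (u : ℝ)..Γ.len f, Γ.bump f (.inner f u) t =
          ∫ t in (u : ℝ)..Γ.len f, (u + (- u / Γ.len f) * t + 0 * t ^ 2) :=
        intervalIntegral.integral_congr fun t ht => by
          rw [uIcc_of_le h1] at ht
          simp only [bump, if_true, min_eq_right ht.1]
          ring
      rw [e1, e2, integral_quadratic, integral_quadratic]
      simp only [bumpInt, if_true]
      field_simp
      ring
    · simp [bump, bumpInt, h]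

theorem IsGreen.green_self (hg : Γ.IsGreen o g) (x : Γ.Point) :
    Γ.green g x x = Γ.interp (fun v => g v v) x +
      2 * ∑ e, (1 - Γ.foster g e) / Γ.len e * bumpInt e x := by
  classical
  cases x with
  | vertex a => simp [green, interp, bumpInt]
  | inner e t =>
    have h := hg.green_self_path (Ioo_subset_Icc_self t.2)
    have := (Γ.len_pos e).ne'
    rw [path_of_mem t.2] at h
    rw [h]
    simp only [interp, bumpInt, mul_ite, mul_zero, Finset.sum_ite_eq, Finset.mem_univ, if_true]
    field_simp

theorem interp_sum {ι : Type*} (s : Finset ι) (F : ι → Γ.V → ℝ) (x : Γ.Point) :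
    Γ.interp (fun v => ∑ i ∈ s, F i v) x = ∑ i ∈ s, Γ.interp (F i) x := by
  obtain ⟨a, b, θ, -, h⟩ := exists_interp_eq x
  simp only [h, Finset.mul_sum, Finset.sum_add_distrib]

theorem interp_sub_mul (c : ℝ) (F₁ F₂ : Γ.V → ℝ) (x : Γ.Point) :
    Γ.interp (fun v => F₁ v - c * F₂ v) x = Γ.interp F₁ x - c * Γ.interp F₂ x := by
  obtain ⟨a, b, θ, -, h⟩ := exists_interp_eq x
  simp only [h]
  ring

theorem interp_add (F₁ F₂ : Γ.V → ℝ) (x : Γ.Point) :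
    Γ.interp (fun v => F₁ v + F₂ v) x = Γ.interp F₁ x + Γ.interp F₂ x := by
  obtain ⟨a, b, θ, -, h⟩ := exists_interp_eq x
  simp only [h]
  ring

theorem interp_const_mul (c : ℝ) (F : Γ.V → ℝ) (x : Γ.Point) :
    Γ.interp (fun v => c * F v) x = c * Γ.interp F x := by
  obtain ⟨a, b, θ, -, h⟩ := exists_interp_eq x
  simp only [h]
  ring

/-- The potential of the canonical measure on the vertices. -/
def canonicalPotential (g : Γ.V → Γ.V → ℝ) (v : Γ.V) : ℝ :=
  (∑ a, g a v) - 1 / 2 * ∑ e, Γ.foster g e * (g (Γ.src e) v + g (Γ.tgt e) v)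

/-- The bump terms are half of those in `IsGreen.green_self`. They cancel in G(x, x) - 2 ∫ G(ζ, x),
leaving the interpolation of a function on the vertices. -/
theorem IsGreen.integral_green (x : Γ.Point) :
    ∫ᵛ ζ, Γ.green g ζ x ∂<•(Γ.canonicalMeasure g) =
      Γ.interp (canonicalPotential g) x +
        ∑ e, (1 - Γ.foster g e) / Γ.len e * bumpInt e x := by
  have h1 : ∀ e, ∫ t in (0 : ℝ)..Γ.len e, Γ.green g (Γ.path e t) x =
      Γ.len e * (Γ.interp (g (Γ.src e)) x + Γ.interp (g (Γ.tgt e)) x) / 2 + bumpInt e x := by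
    intro e
    rw [← integral_lin e (fun v => Γ.interp (g v) x), ← integral_bump,
      ← intervalIntegral.integral_add ((continuous_lin _ _).intervalIntegrable _ _)
        ((continuous_bump _ _).intervalIntegrable _ _)]
    exact intervalIntegral.integral_congr fun t ht =>
      green_path g x (by rwa [uIcc_of_le (Γ.len_pos e).le] at ht)
  rw [integral_canonicalMeasure g (continuous_green g x)]
  simp only [h1]
  have h2 : Γ.interp (canonicalPotential g) x = (∑ a, Γ.interp (g a) x) -
      1 / 2 * ∑ e, Γ.foster g e * (Γ.interp (g (Γ.src e)) x + Γ.interp (g (Γ.tgt e)) x) := by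
    unfold canonicalPotential
    rw [interp_sub_mul, interp_sum, interp_sum]
    simp only [interp_const_mul, interp_add]
  rw [h2, sub_add, sub_eq_add_neg, Finset.mul_sum, ← Finset.sum_sub_distrib,
    ← Finset.sum_neg_distrib]
  congr 1
  refine Finset.sum_congr rfl fun e _ => ?_
  have := (Γ.len_pos e).ne'
  simp only [green]
  field_simp
  ring

/-- By `IsGreen.energy_diag` and Foster's theorem the diagonal and twice the potential have the same
energy pairing with every φ, so they differ by a constant. -/
theorem IsGreen.diag_sub_canonicalPotential (hg : Γ.IsGreen o g) (hΓ : Γ.Rigid) (a b : Γ.V) :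
    g a a - 2 * canonicalPotential g a = g b b - 2 * canonicalPotential g b := by
  have key : ∀ φ, Γ.energy (fun v => g v v - 2 * canonicalPotential g v) φ = 0 := by
    intro φ
    have h1 : Γ.energy (canonicalPotential g) φ = (∑ a, (φ a - φ o)) -
        1 / 2 * ∑ e, Γ.foster g e * ((φ (Γ.src e) - φ o) + (φ (Γ.tgt e) - φ o)) := by
      unfold canonicalPotential
      have h3 : ∀ v y, g v y = g y v := hg.symm
      have h4 : ∀ y, Γ.energy φ (fun x => g y x) = φ y - φ o := fun y => by
        rw [energy_comm, ← hg.energy_eq]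
        simp only [hg.symm y]
      rw [energy_sub_mul_left, energy_comm, energy_sum_right, energy_comm _ φ, energy_sum_right]
      simp only [energy_smul_right, h4]
      congr 2
      refine Finset.sum_congr rfl fun e _ => ?_
      rw [energy_comm, energy_add_left, energy_comm, h4, energy_comm, h4]
    have h2 : ∑ e, Γ.foster g e * ((φ (Γ.src e) - φ o) + (φ (Γ.tgt e) - φ o)) =
        (∑ e, Γ.foster g e * (φ (Γ.src e) + φ (Γ.tgt e))) - 2 * (Fintype.card Γ.V - 1) * φ o := by
      rw [← hg.sum_foster, Finset.mul_sum, Finset.sum_mul, ← Finset.sum_sub_distrib]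
      exact Finset.sum_congr rfl fun e _ => by ring
    rw [energy_sub_mul_left, h1, h2, hg.energy_diag]
    simp only [Finset.sum_sub_distrib, Finset.sum_const, Finset.card_univ, nsmul_eq_mul]
    ring
  exact hΓ.eq_of_energy_eq_zero (key _) a b

theorem integrable_signedMeasure (μ : SignedMeasure Γ.Point) {f : Γ.Point → ℝ}
    (hf : Continuous f) : μ.Integrable f :=
  vectorMeasure_integrable_signedMeasure μ fun ν _ => integrable_of_continuous_point hf ν

theorem IsGreen.voltageOf_self (hg : Γ.IsGreen o g) (hΓ : Γ.Rigid) (μ : SignedMeasure Γ.Point)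
    (x : Γ.Point) : Γ.voltageOf μ x x = ∫ᵛ ζ, Γ.green g ζ ζ ∂<•μ -
      2 * ∫ᵛ ζ, Γ.green g ζ x ∂<•μ + Γ.green g x x * μ univ := by
  have hd := integrable_signedMeasure μ hg.continuous_green_self
  have hx := integrable_signedMeasure μ (continuous_green g x)
  have hx2 : μ.Integrable fun ζ => (2 : ℝ) • Γ.green g ζ x :=
    integrable_signedMeasure μ ((continuous_green g x).const_smul (2 : ℝ))
  have hs : μ.Integrable fun ζ => Γ.green g ζ ζ - (2 : ℝ) • Γ.green g ζ x := hd.sub hx2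
  have hc := integrable_signedMeasure μ (continuous_const (y := Γ.green g x x))
  have h1 : ∀ ζ, Γ.voltage ζ x x =
      (Γ.green g ζ ζ - (2 : ℝ) • Γ.green g ζ x) + Γ.green g x x := fun ζ => by
    rw [hg.voltage_eq hΓ, green_symm hg.symm x ζ, smul_eq_mul]
    ring
  simp only [voltageOf, h1]
  rw [VectorMeasure.integral_fun_add hs hc, VectorMeasure.integral_fun_sub hd hx2,
    VectorMeasure.integral_fun_smul, integral_signedMeasure_const, smul_eq_mul]

theorem IsGreen.integral_green_self (hg : Γ.IsGreen o g) :
    ∫ᵛ ζ, Γ.green g ζ ζ ∂<•(Γ.canonicalMeasure g) = 2 * Γ.tauSum g := by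
  have h1 : ∀ e, ∫ t in (0 : ℝ)..Γ.len e, Γ.green g (Γ.path e t) (Γ.path e t) =
      Γ.len e * (g (Γ.src e) (Γ.src e) + g (Γ.tgt e) (Γ.tgt e)) / 2 +
        (1 - Γ.foster g e) * Γ.len e ^ 2 / 6 := by
    intro e
    have hL := (Γ.len_pos e).ne'
    have h2 : ∫ t in (0 : ℝ)..Γ.len e, Γ.green g (Γ.path e t) (Γ.path e t) =
        ∫ t in (0 : ℝ)..Γ.len e, (g (Γ.src e) (Γ.src e) +
          ((g (Γ.tgt e) (Γ.tgt e) - g (Γ.src e) (Γ.src e)) / Γ.len e + (1 - Γ.foster g e)) * t +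
          (-(1 - Γ.foster g e) / Γ.len e) * t ^ 2) :=
      intervalIntegral.integral_congr fun t ht => by
        rw [uIcc_of_le (Γ.len_pos e).le] at ht
        simp only [hg.green_self_path ht, lin]
        ring
    rw [h2, integral_quadratic]
    field_simp
    ring
  rw [integral_canonicalMeasure g hg.continuous_green_self]
  simp only [h1]
  -- Testing the Laplacian of the diagonal on the diagonal itself trades the sum over vertices for
  -- sums over edges; what remains is an identity on each edge.
  have h3 := hg.energy_diag fun v => g v v
  rw [hg.root] at h3
  have h4 : ∑ a, g a a = 1 / 2 * Γ.energy (fun v => g v v) (fun v => g v v) +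
      1 / 2 * ∑ e, Γ.foster g e * (g (Γ.src e) (Γ.src e) + g (Γ.tgt e) (Γ.tgt e)) := by
    linarith
  simp only [green, interp]
  rw [h4]
  simp only [energy, tauSum, Finset.mul_sum, ← Finset.sum_add_distrib]
  refine Finset.sum_congr rfl fun e _ => ?_
  have := (Γ.len_pos e).ne'
  simp only [tauTerm]
  field_simp
  ring

theorem IsGreen.isCanonicalMeasureWith (hg : Γ.IsGreen o g) (hΓ : Γ.Rigid) :
    Γ.IsCanonicalMeasureWith (Γ.canonicalMeasure g) (2 * Γ.tauSum g) := by
  refine ⟨hg.canonicalMeasure_univ, fun x => ?_⟩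
  rw [hg.voltageOf_self hΓ, hg.integral_green_self, IsGreen.integral_green, hg.green_self,
    hg.canonicalMeasure_univ]
  have h1 : Γ.interp (fun v => g v v - 2 * canonicalPotential g v) x = 0 := by
    obtain ⟨a, b, θ, -, h⟩ := exists_interp_eq x
    -- Both terms vanish at the root, so the constant difference is zero and j_μ(x, x) reduces to ∫
    -- G(ζ, ζ).
    have h2 : g o o - 2 * canonicalPotential g o = 0 := by
      simp [canonicalPotential, hg.symm _ o, hg.root]
    rw [h, hg.diag_sub_canonicalPotential hΓ a o, hg.diag_sub_canonicalPotential hΓ b o, h2]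
    ring
  rw [interp_sub_mul] at h1
  linear_combination h1

/-- The kernel j_ζ(x, x) = r(ζ, x) is symmetric. Integrating it against μ and the explicit canonical
measure in the two orders gives c one way and 2 `tauSum` the other. Uniqueness of μ itself is not
needed. -/
theorem IsGreen.eq_of_isCanonicalMeasureWith (hg : Γ.IsGreen o g) (hΓ : Γ.Rigid)
    {μ : SignedMeasure Γ.Point} {c : ℝ} (hμ : Γ.IsCanonicalMeasureWith μ c) :
    c = 2 * Γ.tauSum g := by
  obtain ⟨C, hC⟩ := exists_abs_green_le g
  have hv : ∀ ζ x, Γ.voltage ζ x x = Γ.green g ζ ζ + Γ.green g x x - 2 * Γ.green g ζ x :=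
    fun ζ x => by
      rw [hg.voltage_eq hΓ, green_symm hg.symm x ζ]
      ring
  have hsymm : ∀ ζ x, Γ.voltage ζ x x = Γ.voltage x ζ ζ := fun ζ x => by
    rw [hv, hv, green_symm hg.symm x ζ]
    ring
  have hcont : ∀ x, Continuous fun ζ => Γ.voltage ζ x x := fun x => by
    simp only [hv]
    exact (hg.continuous_green_self.add continuous_const).sub
      ((continuous_green g x).const_smul (2 : ℝ))
  have hcont' : ∀ ζ, Continuous fun x => Γ.voltage ζ x x := fun ζ => by
    simp only [hsymm ζ]
    exact hcont ζ
  have hbound : ∀ ζ x, |Γ.voltage ζ x x| ≤ 4 * C := fun ζ x => by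
    have h1 := abs_le.1 (hC ζ ζ)
    have h2 := abs_le.1 (hC x x)
    have h3 := abs_le.1 (hC ζ x)
    rw [hv, abs_le]
    constructor <;> linarith
  have hI : ∀ x, μ.Integrable fun ζ => Γ.voltage ζ x x := fun x =>
    integrable_signedMeasure μ (hcont x)
  have hK : ∀ e ζ, Continuous fun t => Γ.voltage ζ (Γ.path e t) (Γ.path e t) := fun e ζ =>
    (hcont' ζ).comp (continuous_path e)
  have hF : ∀ e, ∫ t in (0 : ℝ)..Γ.len e, Γ.voltageOf μ (Γ.path e t) (Γ.path e t) =
      ∫ᵛ ζ, (∫ t in (0 : ℝ)..Γ.len e, Γ.voltage ζ (Γ.path e t) (Γ.path e t)) ∂<•μ := fun e =>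
    intervalIntegral_integral_signedMeasure μ (Γ.len_pos e).le (hK e)
      (fun t => (hcont _).measurable) (fun t ζ => hbound ζ _)
  have hJ : ∀ e, μ.Integrable fun ζ =>
      ∫ t in (0 : ℝ)..Γ.len e, Γ.voltage ζ (Γ.path e t) (Γ.path e t) := fun e =>
    integrable_intervalIntegral_signedMeasure μ (Γ.len_pos e).le (hK e)
      (fun t => (hcont _).measurable) (fun t ζ => hbound ζ _)
  let κ : Γ.E → ℝ := fun e => (1 - Γ.foster g e) / Γ.len e
  have hJ' : ∀ e, μ.Integrable fun ζ =>
      κ e • ∫ t in (0 : ℝ)..Γ.len e, Γ.voltage ζ (Γ.path e t) (Γ.path e t) := fun e =>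
    (hJ e).smul (κ e)
  have hE : ∀ e, μ.Integrable fun ζ => (1 / 2 : ℝ) •
      (Γ.voltage ζ (.vertex (Γ.src e)) (.vertex (Γ.src e)) +
        Γ.voltage ζ (.vertex (Γ.tgt e)) (.vertex (Γ.tgt e))) := fun e =>
    ((hI _).add (hI _)).smul (1 / 2 : ℝ)
  have hJE : ∀ e, μ.Integrable fun ζ =>
      κ e • (∫ t in (0 : ℝ)..Γ.len e, Γ.voltage ζ (Γ.path e t) (Γ.path e t)) - (1 / 2 : ℝ) •
      (Γ.voltage ζ (.vertex (Γ.src e)) (.vertex (Γ.src e)) +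
        Γ.voltage ζ (.vertex (Γ.tgt e)) (.vertex (Γ.tgt e))) := fun e => (hJ' e).sub (hE e)
  have key := integral_canonicalMeasure g (f := fun x => Γ.voltageOf μ x x)
    (by simp only [hμ.2]; exact continuous_const)
  -- For fixed ζ the integral over x against the explicit measure is 2 `tauSum`, by symmetry of the
  -- kernel; it is written as a finite sum so that μ can be integrated term by term.
  have hfib : ∀ ζ, 2 * Γ.tauSum g = (∑ a, Γ.voltage ζ (.vertex a) (.vertex a)) +
      ∑ e, (κ e • (∫ t in (0 : ℝ)..Γ.len e, Γ.voltage ζ (Γ.path e t) (Γ.path e t)) -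
        (1 / 2 : ℝ) • (Γ.voltage ζ (.vertex (Γ.src e)) (.vertex (Γ.src e)) +
          Γ.voltage ζ (.vertex (Γ.tgt e)) (.vertex (Γ.tgt e)))) := fun ζ => by
    have h1 := (hg.isCanonicalMeasureWith hΓ).2 ζ
    have h2 := integral_canonicalMeasure g (hcont' ζ)
    simp only [voltageOf, hsymm _ ζ] at h1
    rw [← h1, h2]
    congr 1
    exact Finset.sum_congr rfl fun e _ => by simp only [smul_eq_mul, κ]; ring
  have h1 := integral_signedMeasure_const μ (2 * Γ.tauSum g)
  rw [hμ.1, mul_one] at h1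
  rw [← h1]
  conv_rhs => enter [2, ζ]; rw [hfib ζ]
  rw [VectorMeasure.integral_fun_add (.fun_finsetSum _ fun a _ => hI _)
    (.fun_finsetSum _ fun e _ => hJE e),
    VectorMeasure.integral_finsetSum _ fun a _ => hI _,
    VectorMeasure.integral_finsetSum _ fun e _ => hJE e]
  have key0 : ∫ᵛ x, Γ.voltageOf μ x x ∂<•(Γ.canonicalMeasure g) = c := by
    simp only [hμ.2, integral_signedMeasure_const, hg.canonicalMeasure_univ, mul_one]
  rw [key0] at key
  refine key.trans ?_
  congr 1
  refine Finset.sum_congr rfl fun e _ => ?_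
  rw [VectorMeasure.integral_fun_sub (hJ' e) (hE e), VectorMeasure.integral_fun_smul,
    VectorMeasure.integral_fun_smul, VectorMeasure.integral_fun_add (hI _) (hI _), hF]
  simp only [smul_eq_mul, κ, voltageOf]
  ring

theorem IsGreen.tau_eq (hg : Γ.IsGreen o g) (hΓ : Γ.Rigid) : Γ.tau = Γ.tauSum g := by
  have h : ∃ c : ℝ, ∃ μ : SignedMeasure Γ.Point, Γ.IsCanonicalMeasureWith μ c :=
    ⟨_, _, hg.isCanonicalMeasureWith hΓ⟩
  obtain ⟨μ, hμ⟩ := h.choose_spec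
  rw [tau, dif_pos h, hg.eq_of_isCanonicalMeasureWith hΓ hμ]
  ring

end Canonical

/-! ### The integral `A` for vertices -/

section AVertices

variable {Γ : MetrizedGraph.{u, v}} {o : Γ.V} {g : Γ.V → Γ.V → ℝ}

/-- The end points are left out because the parametrization is constant beyond them, so the
two-sided derivative there need not be the slope along the edge. -/
theorem integral_congr_Ioo_zero {f₁ f₂ : ℝ → ℝ} {l r : ℝ} (hlr : l ≤ r)
    (h : ∀ t ∈ Ioo l r, f₁ t = f₂ t) : ∫ t in l..r, f₁ t = ∫ t in l..r, f₂ t := by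
  rw [intervalIntegral.integral_of_le hlr, intervalIntegral.integral_of_le hlr,
    integral_Ioc_eq_integral_Ioo, integral_Ioc_eq_integral_Ioo]
  exact setIntegral_congr_fun measurableSet_Ioo h

/-- Since G vanishes at the root, j_x(o, q) = G(x, x) - G(x, q) and j_o(x, q) = G(x, q). On each
edge the first is quadratic and the second affine. -/
theorem IsGreen.A_vertex_eq (hg : Γ.IsGreen o g) (hΓ : Γ.Rigid) (q : Γ.V) :
    Γ.A (.vertex o) (.vertex q) = Γ.ASum g q := by
  have h0 : ∀ x, Γ.green g x (.vertex o) = 0 := fun x => by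
    rw [green_symm hg.symm, hg.green_root]
  have hq : ∀ e, ∀ t ∈ Icc 0 (Γ.len e),
      Γ.green g (Γ.path e t) (.vertex q) = Γ.lin e (fun v => g v q) t := fun e t ht => by
    rw [green_path g _ ht]
    simp [interp, bump]
  simp only [A, edgeIntegral, ASum]
  refine Finset.sum_congr rfl fun e _ => ?_
  have hL := (Γ.len_pos e).ne'
  have hd : ∀ t ∈ Ioo 0 (Γ.len e),
      deriv (fun s => Γ.voltage (.vertex o) (Γ.path e s) (.vertex q)) t =
        (g (Γ.tgt e) q - g (Γ.src e) q) / Γ.len e := fun t ht => by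
    have h1 : (fun s => Γ.voltage (.vertex o) (Γ.path e s) (.vertex q)) =ᶠ[𝓝 t]
        Γ.lin e (fun v => g v q) := by
      filter_upwards [Icc_mem_nhds ht.1 ht.2] with s hs
      rw [hg.voltage_eq hΓ, h0, hg.green_root, hg.green_root, hq e s hs]
      ring
    rw [h1.deriv_eq]
    have h2 := ((hasDerivAt_id' t).const_mul ((g (Γ.tgt e) q - g (Γ.src e) q) / Γ.len e)).const_add
      (g (Γ.src e) q)
    rw [mul_one] at h2
    exact h2.deriv
  set m := (g (Γ.tgt e) q - g (Γ.src e) q) / Γ.len e with hm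
  have h3 : ∀ t ∈ Ioo 0 (Γ.len e), Γ.voltage (Γ.path e t) (.vertex o) (.vertex q) *
      deriv (fun s => Γ.voltage (.vertex o) (Γ.path e s) (.vertex q)) t ^ 2 =
      m ^ 2 * (g (Γ.src e) (Γ.src e) - g (Γ.src e) q) +
        m ^ 2 * ((g (Γ.tgt e) (Γ.tgt e) - g (Γ.src e) (Γ.src e)) / Γ.len e - m +
          (1 - Γ.foster g e)) * t + (-(m ^ 2 * (1 - Γ.foster g e)) / Γ.len e) * t ^ 2 := by
    intro t ht
    have ht' := Ioo_subset_Icc_self ht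
    rw [hd t ht, hg.voltage_eq hΓ, hg.green_root, hg.green_root, hq e t ht',
      hg.green_self_path ht']
    simp only [lin, ← hm]
    ring
  rw [integral_congr_Ioo_zero (Γ.len_pos e).le h3, integral_quadratic]
  have h4 : g (Γ.tgt e) q = g (Γ.src e) q + m * Γ.len e := by
    rw [hm]; field_simp; ring
  rw [h4]
  field_simp
  ring

theorem IsGreen.resistance_vertex_eq (hg : Γ.IsGreen o g) (hΓ : Γ.Rigid) (q : Γ.V) :
    Γ.resistance (.vertex o) (.vertex q) = g q q := by
  rw [hg.resistance_eq hΓ, hg.green_root, hg.green_root]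
  simp [green, interp]

theorem Rigid.tau_identifyVertices (hΓ : Γ.Rigid) (a b : Γ.V) :
    (Γ.identifyVertices a b).tau = Γ.tau - Γ.resistance (.vertex a) (.vertex b) / 6 +
      Γ.A (.vertex a) (.vertex b) / Γ.resistance (.vertex a) (.vertex b) := by
  obtain ⟨g, hg⟩ := hΓ.exists_isGreen a
  obtain ⟨g', hg', h⟩ := hg.exists_identifyVertices hΓ (q := b)
  have h1 : (Γ.identifyVertices a b).tauSum g' =
      Γ.tauSum fun x y => g x y - (g b b)⁻¹ * g x b * g y b := by
    have : (fun x y => g x y - (g b b)⁻¹ * g x b * g y b) =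
        fun x y => g' (Quot.mk _ x) (Quot.mk _ y) := by
      ext x y
      exact (h x y).symm
    rw [this]
    rfl
  rw [hg'.tau_eq (hΓ.identifyVertices a b), h1, hg.tauSum_sub_rankOne, hg.tau_eq hΓ,
    hg.resistance_vertex_eq hΓ, hg.A_vertex_eq hΓ]
  -- In this degenerate case κ = 0 and the quotient A/0 is 0, so both sides are τ(Γ).
  by_cases hr : g b b = 0
  · simp [hr]
  · field_simp
    ring

theorem Rigid.tau_of_deleteEdge {e : Γ.E} (hΓ : (Γ.deleteEdge e).Rigid) {L R A : ℝ}
    (hL : L = Γ.len e)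
    (hR : R = (Γ.deleteEdge e).resistance (.vertex (Γ.src e)) (.vertex (Γ.tgt e)))
    (hA : A = (Γ.deleteEdge e).A (.vertex (Γ.src e)) (.vertex (Γ.tgt e))) :
    Γ.tau = (Γ.deleteEdge e).tau + (A - R ^ 2 / 2) / (L + R) + R ^ 3 / (3 * (L + R) ^ 2)
        + L ^ 3 / (12 * (L + R) ^ 2) + R ^ 2 * L / (4 * (L + R) ^ 2) := by
  obtain ⟨g, hg⟩ := hΓ.exists_isGreen (Γ.src e)
  replace hR : R = g (Γ.tgt e) (Γ.tgt e) := hR.trans (hg.resistance_vertex_eq hΓ (Γ.tgt e))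
  replace hA : A = (Γ.deleteEdge e).ASum g (Γ.tgt e) := hA.trans (hg.A_vertex_eq hΓ (Γ.tgt e))
  have h := hg.of_deleteEdge
  rw [← hL, ← hR] at h
  rw [h.tau_eq hΓ.of_deleteEdge, hg.tau_eq hΓ]
  exact hg.tauSum_of_deleteEdge hL hR hA

theorem resistance_self (Γ : MetrizedGraph.{u, v}) (hΓ : Γ.Rigid) (a : Γ.V) :
    Γ.resistance (.vertex a) (.vertex a) = 0 := by
  obtain ⟨g, hg⟩ := hΓ.exists_isGreen a
  rw [hg.resistance_vertex_eq hΓ, hg.root]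

theorem A_self (Γ : MetrizedGraph.{u, v}) (hΓ : Γ.Rigid) (a : Γ.V) :
    Γ.A (.vertex a) (.vertex a) = 0 := by
  obtain ⟨g, hg⟩ := hΓ.exists_isGreen a
  rw [hg.A_vertex_eq hΓ, ASum]
  refine Finset.sum_eq_zero fun e _ => ?_
  rw [hg.symm _ a, hg.symm _ a, hg.root, hg.root]
  ring

theorem Rigid.resistance_vertex_pos (hΓ : Γ.Rigid) {a b : Γ.V} (h : a ≠ b) :
    0 < Γ.resistance (.vertex a) (.vertex b) := by
  obtain ⟨g, hg⟩ := hΓ.exists_isGreen a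
  rw [hg.resistance_vertex_eq hΓ]
  exact hg.apply_self_pos hΓ h

theorem Rigid.tau_eq_contractEdge_add {e : Γ.E} (hΓ : (Γ.deleteEdge e).Rigid) {L R A : ℝ}
    (hL : L = Γ.len e)
    (hR : R = (Γ.deleteEdge e).resistance (.vertex (Γ.src e)) (.vertex (Γ.tgt e)))
    (hA : A = (Γ.deleteEdge e).A (.vertex (Γ.src e)) (.vertex (Γ.tgt e))) :
    Γ.tau = (Γ.contractEdge e).tau + L / 12 - L * A / (R * (L + R)) := by
  have h1 := hΓ.tau_of_deleteEdge hL hR hA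
  -- Contracting `e` and identifying its ends in Γ - e give the same graph by definition.
  have h2 : (Γ.contractEdge e).tau = (Γ.deleteEdge e).tau - R / 6 + A / R := by
    rw [hR, hA]
    exact hΓ.tau_identifyVertices (Γ.src e) (Γ.tgt e)
  have hL0 : 0 < L := hL ▸ Γ.len_pos e
  rw [h1, h2]
  -- For a self-loop R = A = 0, and division by zero gives the fraction its conventional value 0.
  by_cases h : Γ.src e = Γ.tgt e
  · obtain rfl : R = 0 := by
      rw [hR, ← h]
      exact resistance_self _ hΓ _
    obtain rfl : A = 0 := by
      rw [hA, ← h]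
      exact A_self _ hΓ _
    field_simp
    ring
  · have h0 : 0 < R := hR ▸ hΓ.resistance_vertex_pos h
    field_simp
    ring

/-- After the identification `e` is a self-loop, and deleting it leaves the contracted graph. With R
= A = 0 only L³/(12 L²) survives. -/
theorem Rigid.tau_identifyEnds {e : Γ.E} (hΓ : (Γ.deleteEdge e).Rigid) :
    (Γ.identifyEnds e).tau = (Γ.contractEdge e).tau + Γ.len e / 12 := by
  have hc : ((Γ.identifyEnds e).deleteEdge e).Rigid := hΓ.identifyVertices (Γ.src e) (Γ.tgt e)
  have hend : (Γ.identifyEnds e).src e = (Γ.identifyEnds e).tgt e := Quot.sound ⟨rfl, rfl⟩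
  have h1 := Rigid.tau_of_deleteEdge (Γ := Γ.identifyEnds e) (e := e) (L := Γ.len e) (R := 0)
    (A := 0) hc rfl
    (by rw [← hend]; exact (resistance_self _ hc _).symm)
    (by rw [← hend]; exact (A_self _ hc _).symm)
  rw [h1]
  have := (Γ.len_pos e).ne'
  change _ = ((Γ.identifyEnds e).deleteEdge e).tau + _
  simp only [add_zero]
  field_simp
  ring

end AVertices

/-! ### Subdivision of an edge -/

section Split

variable {Γ : MetrizedGraph.{u, v}} {o : Γ.V} {g : Γ.V → Γ.V → ℝ}

theorem bump_path_self {e : Γ.E} {s u : ℝ} (hs : s ∈ Icc 0 (Γ.len e)) (hu : u ∈ Icc 0 (Γ.len e)) :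
    Γ.bump e (Γ.path e u) s = min s u - s * u / Γ.len e := by
  have hL := (Γ.len_pos e).ne'
  rcases mem_Icc_cases hu with rfl | rfl | h
  · simp [bump, hs.1]
  · simp [bump, hs.2, hL]
  · rw [path_of_mem h]
    simp [bump]

theorem bump_path_of_ne {e f : Γ.E} (h : f ≠ e) (s u : ℝ) : Γ.bump e (Γ.path f u) s = 0 := by
  unfold path
  split_ifs <;> simp [bump, h]

theorem point_cases (x : Γ.Point) : (∃ a, x = .vertex a) ∨
    ∃ e, ∃ t ∈ Icc 0 (Γ.len e), x = Γ.path e t := by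
  cases x with
  | vertex a => exact .inl ⟨a, rfl⟩
  | inner e t => exact .inr ⟨e, t, Ioo_subset_Icc_self t.2, (path_of_mem t.2).symm⟩

variable (e : Γ.E) (t : Ioo (0 : ℝ) (Γ.len e))

/-- The edge of the subdivided graph that comes from the edge `f`: for `f = e` it is the first
part of `e`. -/
def splitOldEdge (f : Γ.E) : (Γ.splitEdge e t).E := some f

/-- The second part of the edge `e` in the subdivided graph. -/
def splitNewEdge : (Γ.splitEdge e t).E := none

/-- A vertex, as a vertex of the subdivided graph. -/
def splitOldVertex (a : Γ.V) : (Γ.splitEdge e t).V := some a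

/-- The new vertex of the subdivided graph. -/
def splitNewVertex : (Γ.splitEdge e t).V := none

/-- A point, as a point of the subdivided graph. -/
def splitPoint (x : Γ.Point) : (Γ.splitEdge e t).Point := Γ.subdividePoint (.inner e t) x

variable {e t}

theorem splitVertex_cases (w : (Γ.splitEdge e t).V) :
    w = splitNewVertex e t ∨ ∃ a, w = splitOldVertex e t a := by
  cases w with
  | none => exact .inl rfl
  | some a => exact .inr ⟨a, rfl⟩

theorem splitOldEdge_ne {f f' : Γ.E} (h : f ≠ f') : splitOldEdge e t f ≠ splitOldEdge e t f' :=
  fun h' => h (Option.some.inj h')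

theorem splitOldEdge_ne_splitNewEdge (f : Γ.E) : splitOldEdge e t f ≠ splitNewEdge e t :=
  Option.some_ne_none f

theorem sum_splitEdge (φ : (Γ.splitEdge e t).E → ℝ) :
    ∑ f, φ f = φ (splitNewEdge e t) + ∑ f, φ (splitOldEdge e t f) := by
  refine Eq.trans ?_ (Fintype.sum_option φ)
  exact @Fintype.sum_equiv (Γ.splitEdge e t).E (Option Γ.E) ℝ
    (Γ.splitEdge e t).instFintypeE _ _ (Equiv.refl _) _ _ fun _ => rfl

theorem src_splitOldEdge (f : Γ.E) :
    (Γ.splitEdge e t).src (splitOldEdge e t f) = splitOldVertex e t (Γ.src f) := rfl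

theorem src_splitNewEdge : (Γ.splitEdge e t).src (splitNewEdge e t) = splitNewVertex e t := rfl

theorem tgt_splitNewEdge :
    (Γ.splitEdge e t).tgt (splitNewEdge e t) = splitOldVertex e t (Γ.tgt e) := rfl

theorem len_splitNewEdge : (Γ.splitEdge e t).len (splitNewEdge e t) = Γ.len e - t := rfl

theorem tgt_splitOldEdge_self :
    (Γ.splitEdge e t).tgt (splitOldEdge e t e) = splitNewVertex e t := if_pos rfl

theorem len_splitOldEdge_self : (Γ.splitEdge e t).len (splitOldEdge e t e) = t := if_pos rfl

theorem tgt_splitOldEdge_of_ne {f : Γ.E} (h : f ≠ e) :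
    (Γ.splitEdge e t).tgt (splitOldEdge e t f) = splitOldVertex e t (Γ.tgt f) := if_neg h

theorem len_splitOldEdge_of_ne {f : Γ.E} (h : f ≠ e) :
    (Γ.splitEdge e t).len (splitOldEdge e t f) = Γ.len f := if_neg h

theorem Rigid.splitEdge (hΓ : Γ.Rigid) (e : Γ.E) (t : Ioo (0 : ℝ) (Γ.len e)) :
    (Γ.splitEdge e t).Rigid := by
  intro f hf
  have h1 : f (splitOldVertex e t (Γ.src e)) = f (splitNewVertex e t) := by
    have := hf (splitOldEdge e t e)
    rwa [src_splitOldEdge, tgt_splitOldEdge_self] at this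
  have h2 : f (splitNewVertex e t) = f (splitOldVertex e t (Γ.tgt e)) := hf (splitNewEdge e t)
  have h3 : ∀ a b : Γ.V, f (splitOldVertex e t a) = f (splitOldVertex e t b) :=
    hΓ (fun a => f (splitOldVertex e t a)) fun e' => by
      by_cases h : e' = e
      · rw [h, h1, h2]
      · have := hf (splitOldEdge e t e')
        rwa [src_splitOldEdge, tgt_splitOldEdge_of_ne h] at this
  have h4 : ∀ a, f a = f (splitNewVertex e t) := by
    intro a
    rcases splitVertex_cases a with rfl | ⟨a, rfl⟩
    · rfl
    · rw [h3 a (Γ.src e), h1]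
  intro a b
  rw [h4 a, h4 b]

variable (e t) in
/-- The vertices of the subdivided graph, as points of the original graph. -/
def splitVertex : (Γ.splitEdge e t).V → Γ.Point
  | none => .inner e t
  | some a => .vertex a

theorem splitVertex_old (a : Γ.V) : splitVertex e t (splitOldVertex e t a) = .vertex a := rfl

theorem splitVertex_new : splitVertex e t (splitNewVertex e t) = .inner e t := rfl

variable (g e t) in
/-- The Green function of the subdivided graph. -/
def splitGreen (v w : (Γ.splitEdge e t).V) : ℝ := Γ.green g (splitVertex e t v) (splitVertex e t w)

theorem splitGreen_eq (v w : (Γ.splitEdge e t).V) :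
    splitGreen g e t v w = Γ.green g (splitVertex e t v) (splitVertex e t w) := rfl

theorem IsGreen.green_vertex_right (hg : Γ.IsGreen o g) (x : Γ.Point) (a : Γ.V) :
    Γ.green g x (.vertex a) = Γ.interp (g a) x := by
  rw [green_symm hg.symm]; rfl

/-- The energies of the two graphs differ only on `e`. If w is an old vertex, the three values on
`e` lie on one line and the difference is zero. If w is the new vertex, the bump term moves the
interpolated source from the ends of `e` to w. -/
theorem IsGreen.splitGreen (hg : Γ.IsGreen o g) (e : Γ.E) (t : Ioo (0 : ℝ) (Γ.len e)) :
    (Γ.splitEdge e t).IsGreen (splitOldVertex e t o) (splitGreen g e t) := by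
  classical
  refine ⟨fun y => hg.green_root _, fun w φ => ?_⟩
  have hL := (Γ.len_pos e).ne'
  have ht := t.2.1.ne'
  have ht' := (sub_pos.2 t.2.2).ne'
  obtain ⟨y, hy⟩ : ∃ y, y = splitVertex e t w := ⟨_, rfl⟩
  have hE := hg.energy_interp y fun a => φ (splitOldVertex e t a)
  set F : Γ.V → ℝ := fun v => Γ.interp (g v) y with hF
  have hsome : ∀ a, MetrizedGraph.splitGreen g e t (splitOldVertex e t a) w = F a := fun a => by
    rw [hF, hy]; rfl
  have hnone : MetrizedGraph.splitGreen g e t (splitNewVertex e t) w =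
      Γ.lin e F t + Γ.bump e y t := by
    rw [hF, hy]; rfl
  set P := Γ.lin e F t + Γ.bump e y t with hP
  have h1 : (Γ.splitEdge e t).energy (fun x => MetrizedGraph.splitGreen g e t x w) φ =
      Γ.energy F (fun a => φ (splitOldVertex e t a)) +
        ((F (Γ.tgt e) - P) * (φ (splitOldVertex e t (Γ.tgt e)) - φ (splitNewVertex e t)) /
        (Γ.len e - t) +
        (P - F (Γ.src e)) * (φ (splitNewVertex e t) - φ (splitOldVertex e t (Γ.src e))) / t -
        (F (Γ.tgt e) - F (Γ.src e)) * (φ (splitOldVertex e t (Γ.tgt e)) -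
          φ (splitOldVertex e t (Γ.src e))) / Γ.len e) := by
    have h2 : ∀ f, (MetrizedGraph.splitGreen g e t ((Γ.splitEdge e t).tgt (splitOldEdge e t f)) w -
          MetrizedGraph.splitGreen g e t ((Γ.splitEdge e t).src (splitOldEdge e t f)) w) *
          (φ ((Γ.splitEdge e t).tgt (splitOldEdge e t f)) -
            φ ((Γ.splitEdge e t).src (splitOldEdge e t f))) /
            (Γ.splitEdge e t).len (splitOldEdge e t f) =
        (F (Γ.tgt f) - F (Γ.src f)) * (φ (splitOldVertex e t (Γ.tgt f)) -
          φ (splitOldVertex e t (Γ.src f))) / Γ.len f +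
        if f = e then
          (P - F (Γ.src e)) * (φ (splitNewVertex e t) - φ (splitOldVertex e t (Γ.src e))) / t -
          (F (Γ.tgt e) - F (Γ.src e)) * (φ (splitOldVertex e t (Γ.tgt e)) -
            φ (splitOldVertex e t (Γ.src e))) / Γ.len e
        else 0 := by
      intro f
      by_cases h : f = e
      · subst h
        rw [if_pos rfl, tgt_splitOldEdge_self, len_splitOldEdge_self, src_splitOldEdge, hsome,
          hnone]
        ring
      · rw [if_neg h, tgt_splitOldEdge_of_ne h, len_splitOldEdge_of_ne h, src_splitOldEdge, hsome,
          hsome, add_zero]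
    rw [energy, sum_splitEdge, Finset.sum_congr rfl fun f _ => h2 f, Finset.sum_add_distrib,
      Finset.sum_ite_eq', if_pos (Finset.mem_univ _), tgt_splitNewEdge, len_splitNewEdge,
      src_splitNewEdge, hsome, hnone, energy]
    ring
  rw [h1, hE, hP]
  rcases splitVertex_cases w with rfl | ⟨b, rfl⟩
  · rw [hy, splitVertex_new]
    simp only [interp, bump, lin, if_true, min_self]
    field_simp
    ring
  · rw [hy, splitVertex_old]
    simp only [interp, bump, lin]
    field_simp
    ring

theorem splitPoint_vertex (a : Γ.V) :
    splitPoint e t (.vertex a) = .vertex (splitOldVertex e t a) := rfl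

theorem splitPoint_path_of_ne {f : Γ.E} (h : f ≠ e) (s : ℝ) :
    splitPoint e t (Γ.path f s) = (Γ.splitEdge e t).path (splitOldEdge e t f) s := by
  rcases le_or_gt s 0 with h0 | h0
  · rw [path_of_nonpos h0, path_of_nonpos h0]; rfl
  · rcases le_or_gt (Γ.len f) s with h1 | h1
    · rw [path_of_len_le h1, path_of_len_le (by rwa [len_splitOldEdge_of_ne h]),
        tgt_splitOldEdge_of_ne h]
      rfl
    · rw [path_of_mem ⟨h0, h1⟩]
      exact if_neg fun h' => h h'.1

theorem splitPoint_path_left {s : ℝ} (hs : s ≤ t) :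
    splitPoint e t (Γ.path e s) = (Γ.splitEdge e t).path (splitOldEdge e t e) s := by
  rcases le_or_gt s 0 with h0 | h0
  · rw [path_of_nonpos h0, path_of_nonpos h0]; rfl
  · have h1 : s ∈ Ioo 0 (Γ.len e) := ⟨h0, hs.trans_lt t.2.2⟩
    rw [path_of_mem h1]
    rcases hs.eq_or_lt with rfl | h2
    · rw [path_of_len_le (by rw [len_splitOldEdge_self]), tgt_splitOldEdge_self]
      refine (if_pos ⟨rfl, le_rfl⟩).trans ?_
      exact path_of_nonpos (Γ := Γ.splitEdge e t) (e := splitNewEdge e t) (by simp)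
    · exact if_neg fun h' => h'.2.not_gt h2

theorem splitPoint_path_right {s : ℝ} (hs : t ≤ s) :
    splitPoint e t (Γ.path e s) = (Γ.splitEdge e t).path (splitNewEdge e t) (s - t) := by
  rcases le_or_gt (Γ.len e) s with h1 | h1
  · rw [path_of_len_le h1, path_of_len_le (by rw [len_splitNewEdge]; linarith)]
    rfl
  · rw [path_of_mem ⟨t.2.1.trans_le hs, h1⟩]
    exact if_pos ⟨rfl, hs⟩

theorem splitPoint_inner : splitPoint e t (.inner e t) = .vertex (splitNewVertex e t) := by
  have h := splitPoint_path_left (Γ := Γ) (e := e) (t := t) le_rfl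
  rwa [path_of_mem t.2, path_of_len_le (by rw [len_splitOldEdge_self]),
    tgt_splitOldEdge_self] at h

theorem bump_splitOldEdge_of_ne {f : Γ.E} (h : f ≠ e) {s : ℝ} (hs : s ∈ Icc 0 (Γ.len f))
    (y : Γ.Point) :
    (Γ.splitEdge e t).bump (splitOldEdge e t f) (splitPoint e t y) s = Γ.bump f y s := by
  rcases point_cases y with ⟨a, rfl⟩ | ⟨f', u, hu, rfl⟩
  · rfl
  · by_cases h' : f' = e
    · subst h'
      rw [bump_path_of_ne h.symm]
      rcases le_total u t with h1 | h1
      · rw [splitPoint_path_left h1, bump_path_of_ne (splitOldEdge_ne h.symm)]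
      · rw [splitPoint_path_right h1, bump_path_of_ne (splitOldEdge_ne_splitNewEdge f).symm]
    · rw [splitPoint_path_of_ne h']
      by_cases h2 : f' = f
      · subst h2
        rw [bump_path_self (by rwa [len_splitOldEdge_of_ne h])
          (by rwa [len_splitOldEdge_of_ne h]), bump_path_self hs hu, len_splitOldEdge_of_ne h]
      · rw [bump_path_of_ne h2, bump_path_of_ne (splitOldEdge_ne h2)]

/-- On [0, t] the bump function of `e` minus its chord vanishes at both ends and keeps the kink at
y, so it is the bump function of that part. The same holds on the second part. -/
theorem bump_splitOldEdge_self {s : ℝ} (hs : s ∈ Icc (0 : ℝ) t) (y : Γ.Point) :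
    (Γ.splitEdge e t).bump (splitOldEdge e t e) (splitPoint e t y) s =
      Γ.bump e y s - Γ.bump e y t / t * s := by
  have ht := t.2.1.ne'
  have hL := (Γ.len_pos e).ne'
  have hs' : s ∈ Icc 0 (Γ.len e) := ⟨hs.1, hs.2.trans t.2.2.le⟩
  rcases point_cases y with ⟨a, rfl⟩ | ⟨f, u, hu, rfl⟩
  · simp [splitPoint_vertex, bump]
  · by_cases h : f = e
    · subst h
      rw [bump_path_self hs' hu, bump_path_self (Ioo_subset_Icc_self t.2) hu]
      rcases le_total u t with h1 | h1
      · rw [splitPoint_path_left h1, bump_path_self (by rwa [len_splitOldEdge_self])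
          (by rw [len_splitOldEdge_self]; exact ⟨hu.1, h1⟩), len_splitOldEdge_self,
          min_eq_right h1]
        field_simp
        ring
      · rw [splitPoint_path_right h1, bump_path_of_ne (splitOldEdge_ne_splitNewEdge f).symm,
          min_eq_left (hs.2.trans h1), min_eq_left h1]
        field_simp
        ring
    · rw [splitPoint_path_of_ne h, bump_path_of_ne h, bump_path_of_ne h,
        bump_path_of_ne (splitOldEdge_ne h)]
      ring

theorem bump_splitNewEdge {s : ℝ} (hs : s ∈ Icc (t : ℝ) (Γ.len e)) (y : Γ.Point) :
    (Γ.splitEdge e t).bump (splitNewEdge e t) (splitPoint e t y) (s - t) =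
      Γ.bump e y s - Γ.bump e y t / (Γ.len e - t) * (Γ.len e - s) := by
  have ht := (sub_pos.2 t.2.2).ne'
  have hL := (Γ.len_pos e).ne'
  have hs' : s ∈ Icc 0 (Γ.len e) := ⟨t.2.1.le.trans hs.1, hs.2⟩
  rcases point_cases y with ⟨a, rfl⟩ | ⟨f, u, hu, rfl⟩
  · simp [splitPoint_vertex, bump]
  · by_cases h : f = e
    · subst h
      rw [bump_path_self hs' hu, bump_path_self (Ioo_subset_Icc_self t.2) hu]
      rcases le_total u t with h1 | h1
      · rw [splitPoint_path_left h1, bump_path_of_ne (splitOldEdge_ne_splitNewEdge f),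
          min_eq_right (h1.trans hs.1), min_eq_right h1]
        field_simp
        ring
      · rw [splitPoint_path_right h1, bump_path_self
          (by rw [len_splitNewEdge]; exact ⟨by linarith [hs.1], by linarith [hs.2]⟩)
          (by rw [len_splitNewEdge]; exact ⟨by linarith, by linarith [hu.2]⟩),
          len_splitNewEdge, min_eq_left h1, min_sub_sub_right]
        field_simp
        ring
    · rw [splitPoint_path_of_ne h, bump_path_of_ne h, bump_path_of_ne h,
        bump_path_of_ne (splitOldEdge_ne_splitNewEdge f)]
      ring

/-- On each part of a subdivided edge, the Green function of the original graph is the affine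
interpolation up to the bump function of that part. -/
theorem green_path_of_ne {f : Γ.E} (h : f ≠ e) {s : ℝ} (hs : s ∈ Icc 0 (Γ.len f)) (y : Γ.Point) :
    Γ.green g (Γ.path f s) y = (Γ.splitEdge e t).lin (splitOldEdge e t f)
        (fun v => Γ.green g (splitVertex e t v) y) s +
      (Γ.splitEdge e t).bump (splitOldEdge e t f) (splitPoint e t y) s := by
  rw [bump_splitOldEdge_of_ne h hs, green_path g y hs, lin, lin, src_splitOldEdge,
    tgt_splitOldEdge_of_ne h, len_splitOldEdge_of_ne h]
  rfl

theorem green_path_left {s : ℝ} (hs : s ∈ Icc (0 : ℝ) t) (y : Γ.Point) :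
    Γ.green g (Γ.path e s) y = (Γ.splitEdge e t).lin (splitOldEdge e t e)
        (fun v => Γ.green g (splitVertex e t v) y) s +
      (Γ.splitEdge e t).bump (splitOldEdge e t e) (splitPoint e t y) s := by
  have hL := (Γ.len_pos e).ne'
  have ht := t.2.1.ne'
  rw [bump_splitOldEdge_self hs, green_path g y ⟨hs.1, hs.2.trans t.2.2.le⟩, lin, lin,
    src_splitOldEdge, tgt_splitOldEdge_self, len_splitOldEdge_self]
  simp only [splitVertex_old, splitVertex_new, green, lin]
  field_simp
  ring

theorem green_path_right {s : ℝ} (hs : s ∈ Icc (t : ℝ) (Γ.len e)) (y : Γ.Point) :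
    Γ.green g (Γ.path e s) y = (Γ.splitEdge e t).lin (splitNewEdge e t)
        (fun v => Γ.green g (splitVertex e t v) y) (s - t) +
      (Γ.splitEdge e t).bump (splitNewEdge e t) (splitPoint e t y) (s - t) := by
  have hL := (Γ.len_pos e).ne'
  have ht := (sub_pos.2 t.2.2).ne'
  rw [bump_splitNewEdge hs, green_path g y ⟨t.2.1.le.trans hs.1, hs.2⟩, lin, lin,
    src_splitNewEdge, tgt_splitNewEdge, len_splitNewEdge]
  simp only [splitVertex_old, splitVertex_new, green, lin]
  field_simp
  ring

theorem splitPoint_splitVertex (v : (Γ.splitEdge e t).V) :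
    splitPoint e t (splitVertex e t v) = .vertex v := by
  rcases splitVertex_cases v with rfl | ⟨a, rfl⟩
  · rw [splitVertex_new, splitPoint_inner]
  · rw [splitVertex_old, splitPoint_vertex]

theorem IsGreen.interp_splitGreen (hg : Γ.IsGreen o g) (v : (Γ.splitEdge e t).V) (y : Γ.Point) :
    (Γ.splitEdge e t).interp (MetrizedGraph.splitGreen g e t v) (splitPoint e t y) =
      Γ.green g (splitVertex e t v) y := by
  have hv : MetrizedGraph.splitGreen g e t v =
      fun w => Γ.green g (splitVertex e t w) (splitVertex e t v) := by
    ext w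
    exact green_symm hg.symm _ _
  rw [hv, green_symm hg.symm (splitVertex e t v) y]
  rcases point_cases y with ⟨a, rfl⟩ | ⟨f, s, hs, rfl⟩
  · rfl
  by_cases h : f = e
  · subst h
    rcases le_total s t with h1 | h1
    · rw [splitPoint_path_left h1, interp_path _ (by rw [len_splitOldEdge_self]; exact ⟨hs.1, h1⟩),
        green_path_left ⟨hs.1, h1⟩, splitPoint_splitVertex]
      simp [bump]
    · rw [splitPoint_path_right h1, interp_path _
          (by rw [len_splitNewEdge]; exact ⟨by linarith, by linarith [hs.2]⟩),
        green_path_right ⟨h1, hs.2⟩, splitPoint_splitVertex]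
      simp [bump]
  · rw [splitPoint_path_of_ne h, interp_path _ (by rwa [len_splitOldEdge_of_ne h]),
      green_path_of_ne h hs, splitPoint_splitVertex]
    simp [bump]

theorem IsGreen.green_splitGreen (hg : Γ.IsGreen o g) (x y : Γ.Point) :
    (Γ.splitEdge e t).green (MetrizedGraph.splitGreen g e t) (splitPoint e t x)
      (splitPoint e t y) = Γ.green g x y := by
  rcases point_cases x with ⟨a, rfl⟩ | ⟨f, s, hs, rfl⟩
  · exact hg.interp_splitGreen (splitOldVertex e t a) y
  by_cases h : f = e
  · subst h
    rcases le_total s t with h1 | h1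
    · rw [splitPoint_path_left h1, green_path _ _ (by rw [len_splitOldEdge_self]; exact ⟨hs.1, h1⟩),
        green_path_left ⟨hs.1, h1⟩]
      simp only [hg.interp_splitGreen]
    · rw [splitPoint_path_right h1, green_path _ _
          (by rw [len_splitNewEdge]; exact ⟨by linarith, by linarith [hs.2]⟩),
        green_path_right ⟨h1, hs.2⟩]
      simp only [hg.interp_splitGreen]
  · rw [splitPoint_path_of_ne h, green_path _ _ (by rwa [len_splitOldEdge_of_ne h]),
      green_path_of_ne (t := t) h hs]
    simp only [hg.interp_splitGreen]

end Split

/-! ### Invariance under subdivision -/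

section Invariance

variable {Γ : MetrizedGraph.{u, v}} {o : Γ.V} {g : Γ.V → Γ.V → ℝ} {e : Γ.E}
  {t : Ioo (0 : ℝ) (Γ.len e)}

theorem Rigid.voltage_splitPoint (hΓ : Γ.Rigid) (z x y : Γ.Point) :
    (Γ.splitEdge e t).voltage (splitPoint e t z) (splitPoint e t x) (splitPoint e t y) =
      Γ.voltage z x y := by
  obtain ⟨g, hg⟩ := hΓ.exists_isGreen (Γ.src e)
  rw [hg.voltage_eq hΓ, (hg.splitGreen e t).voltage_eq (hΓ.splitEdge e t)]
  simp only [hg.green_splitGreen]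

theorem Rigid.tau_splitEdge (hΓ : Γ.Rigid) (e : Γ.E) (t : Ioo (0 : ℝ) (Γ.len e)) :
    (Γ.splitEdge e t).tau = Γ.tau := by
  classical
  obtain ⟨g, hg⟩ := hΓ.exists_isGreen (Γ.src e)
  rw [hg.tau_eq hΓ, (hg.splitGreen e t).tau_eq (hΓ.splitEdge e t), tauSum, sum_splitEdge]
  have hL := (Γ.len_pos e).ne'
  have ht := t.2.1.ne'
  have ht' := (sub_pos.2 t.2.2).ne'
  have h1 : ∀ f ≠ e, (Γ.splitEdge e t).tauTerm (MetrizedGraph.splitGreen g e t)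
      (splitOldEdge e t f) = Γ.tauTerm g f := fun f h => by
    rw [tauTerm, foster, tgt_splitOldEdge_of_ne h, len_splitOldEdge_of_ne h, src_splitOldEdge]
    rfl
  -- Each term is ¼ ∫ (d/dx r(o, x))² dx over its edge, which is additive when the edge is cut.
  have h2 : (Γ.splitEdge e t).tauTerm (MetrizedGraph.splitGreen g e t) (splitNewEdge e t) +
      (Γ.splitEdge e t).tauTerm (MetrizedGraph.splitGreen g e t) (splitOldEdge e t e) =
        Γ.tauTerm g e := by
    have hp := hg.green_self_path (Ioo_subset_Icc_self t.2)
    rw [path_of_mem t.2] at hp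
    simp only [tauTerm, foster, tgt_splitOldEdge_self, len_splitOldEdge_self, src_splitOldEdge,
      tgt_splitNewEdge, len_splitNewEdge, src_splitNewEdge, splitGreen_eq, splitVertex_old,
      splitVertex_new, hp, hg.green_vertex_right (.inner e t)]
    simp only [green, interp, lin, hg.symm (Γ.tgt e) (Γ.src e)]
    field_simp
    ring
  rw [← Finset.add_sum_erase _ _ (Finset.mem_univ e), ← add_assoc, h2, tauSum,
    ← Finset.add_sum_erase _ _ (Finset.mem_univ e)]
  congr 1
  exact Finset.sum_congr rfl fun f hf => h1 f (Finset.ne_of_mem_erase hf)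

theorem abs_bump_sub_le (e : Γ.E) (y : Γ.Point) (s s' : ℝ) :
    |Γ.bump e y s - Γ.bump e y s'| ≤ 2 * |s - s'| := by
  cases y with
  | vertex a => simp [bump]
  | inner f u =>
    by_cases h : f = e
    · subst h
      have hL := Γ.len_pos f
      have h1 : |min s u - min s' u| ≤ |s - s'| := by
        simpa using abs_min_sub_min_le_max s u s' u
      have h2 : |(s - s') * (u / Γ.len f)| ≤ |s - s'| := by
        rw [abs_mul, abs_of_nonneg (div_nonneg u.2.1.le hL.le)]
        exact mul_le_of_le_one_right (abs_nonneg _) (div_le_one_of_le₀ u.2.2.le hL.le)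
      have h3 : Γ.bump f (.inner f u) s - Γ.bump f (.inner f u) s' =
          (min s u - min s' u) - (s - s') * (u / Γ.len f) := by
        simp only [bump, if_true]
        ring
      rw [h3]
      exact (abs_sub _ _).trans (by linarith)
    · simp [bump, h]

/-- Needed to cut the integral at the new vertex. The voltage is Lipschitz along the edge, so its
derivative is bounded, whatever happens at the kinks p and q. -/
theorem IsGreen.intervalIntegrable_A (hg : Γ.IsGreen o g) (hΓ : Γ.Rigid) (p q : Γ.Point) (e : Γ.E) :
    IntervalIntegrable (fun s => Γ.voltage (Γ.path e s) p q *
      deriv (fun s => Γ.voltage p (Γ.path e s) q) s ^ 2) volume 0 (Γ.len e) := by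
  have hL := (Γ.len_pos e).le
  have hc : Continuous fun s => Γ.voltage (Γ.path e s) p q := by
    simp only [hg.voltage_eq hΓ]
    have h1 := (continuous_green g q).comp (continuous_path e)
    have h2 := hg.continuous_green_self.comp (continuous_path e)
    have h3 : Continuous fun s => Γ.green g p (Γ.path e s) := by
      simp only [green_symm hg.symm p]
      exact (continuous_green g p).comp (continuous_path e)
    exact (continuous_const.sub h3).sub (h1.sub h2)
  obtain ⟨C, hC⟩ := exists_abs_green_le g
  have hbound : ∀ s, |Γ.voltage (Γ.path e s) p q| ≤ 4 * C := fun s => by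
    have h1 := abs_le.1 (hC p q)
    have h2 := abs_le.1 (hC p (Γ.path e s))
    have h3 := abs_le.1 (hC (Γ.path e s) q)
    have h4 := abs_le.1 (hC (Γ.path e s) (Γ.path e s))
    rw [hg.voltage_eq hΓ, abs_le]
    constructor <;> linarith
  let m : Γ.Point → ℝ := fun y =>
    (Γ.interp (g (Γ.tgt e)) y - Γ.interp (g (Γ.src e)) y) / Γ.len e
  have hder : ∀ s ∈ Ioo 0 (Γ.len e),
      |deriv (fun s => Γ.voltage p (Γ.path e s) q) s| ≤ |m q - m p| + 4 := by
    intro s hs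
    rw [← Real.norm_eq_abs]
    refine norm_deriv_le_of_lip' (by positivity) ?_
    filter_upwards [Icc_mem_nhds hs.1 hs.2] with s' hs'
    have hs := Ioo_subset_Icc_self hs
    rw [hg.voltage_eq hΓ, hg.voltage_eq hΓ, green_path g q hs', green_path g p hs',
      green_path g q hs, green_path g p hs, Real.norm_eq_abs, Real.norm_eq_abs]
    have h1 := abs_bump_sub_le e q s' s
    have h2 := abs_bump_sub_le e p s' s
    refine le_trans (le_of_eq_of_le (congrArg _ ?_) ((abs_sub _ _).trans
      (add_le_add (abs_add_le ((m q - m p) * (s' - s)) (Γ.bump e q s' - Γ.bump e q s)) h2))) ?_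
    · simp only [lin, m]
      ring
    · rw [abs_mul]
      linarith
  rw [intervalIntegrable_iff_integrableOn_Ioo_of_le hL]
  refine Measure.integrableOn_of_bounded (M := 4 * C * (|m q - m p| + 4) ^ 2) (by simp)
    (hc.measurable.mul ((measurable_deriv _).pow_const 2)).aestronglyMeasurable ?_
  refine (ae_restrict_iff' measurableSet_Ioo).2 (.of_forall fun s hs => ?_)
  rw [Real.norm_eq_abs, abs_mul, abs_pow]
  exact mul_le_mul (hbound s) (pow_le_pow_left₀ (abs_nonneg _) (hder s hs) 2) (by positivity)
    ((abs_nonneg _).trans (hbound s))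

theorem Rigid.A_splitPoint (hΓ : Γ.Rigid) (p q : Γ.Point) :
    (Γ.splitEdge e t).A (splitPoint e t p) (splitPoint e t q) = Γ.A p q := by
  classical
  obtain ⟨g, hg⟩ := hΓ.exists_isGreen (Γ.src e)
  have hV := hΓ.voltage_splitPoint (e := e) (t := t)
  have ht := t.2.1.le
  have ht' := t.2.2.le
  have hint := hg.intervalIntegrable_A hΓ p q e
  have hleft : IntervalIntegrable (fun s => Γ.voltage (Γ.path e s) p q *
      deriv (fun s => Γ.voltage p (Γ.path e s) q) s ^ 2) volume 0 t :=
    hint.mono_set (by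
      rw [uIcc_of_le ht, uIcc_of_le (Γ.len_pos e).le]
      exact Icc_subset_Icc_right ht')
  have hright : IntervalIntegrable (fun s => Γ.voltage (Γ.path e s) p q *
      deriv (fun s => Γ.voltage p (Γ.path e s) q) s ^ 2) volume t (Γ.len e) :=
    hint.mono_set (by
      rw [uIcc_of_le ht', uIcc_of_le (Γ.len_pos e).le]
      exact Icc_subset_Icc_left ht)
  simp only [A, edgeIntegral]
  rw [sum_splitEdge, ← Finset.add_sum_erase _ _ (Finset.mem_univ e), ← add_assoc,
    ← Finset.add_sum_erase _ _ (Finset.mem_univ e)]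
  congr 1
  · rw [← intervalIntegral.integral_add_adjacent_intervals hleft hright, add_comm,
      len_splitOldEdge_self, len_splitNewEdge]
    congr 1
    · refine integral_congr_Ioo_zero ht fun s hs => ?_
      have h1 : (fun s => (Γ.splitEdge e t).voltage (splitPoint e t p)
          ((Γ.splitEdge e t).path (splitOldEdge e t e) s) (splitPoint e t q)) =ᶠ[𝓝 s]
          fun s => Γ.voltage p (Γ.path e s) q := by
        filter_upwards [Iio_mem_nhds hs.2] with s' hs'
        rw [← splitPoint_path_left (mem_Iio.1 hs').le, hV]
      rw [h1.deriv_eq, ← splitPoint_path_left hs.2.le, hV]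
    · have h0 := intervalIntegral.integral_comp_sub_right (a := (t : ℝ)) (b := Γ.len e)
        (fun s => (Γ.splitEdge e t).voltage ((Γ.splitEdge e t).path (splitNewEdge e t) s)
          (splitPoint e t p) (splitPoint e t q) * deriv (fun s => (Γ.splitEdge e t).voltage
            (splitPoint e t p) ((Γ.splitEdge e t).path (splitNewEdge e t) s)
              (splitPoint e t q)) s ^ 2) (t : ℝ)
      rw [sub_self] at h0
      rw [← h0]
      refine integral_congr_Ioo_zero ht' fun s hs => ?_
      have h1 : (fun s => (Γ.splitEdge e t).voltage (splitPoint e t p)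
          ((Γ.splitEdge e t).path (splitNewEdge e t) (s - t)) (splitPoint e t q)) =ᶠ[𝓝 s]
          fun s => Γ.voltage p (Γ.path e s) q := by
        filter_upwards [Ioi_mem_nhds hs.1] with s' hs'
        rw [← splitPoint_path_right (mem_Ioi.1 hs').le, hV]
      rw [← h1.deriv_eq, deriv_comp_sub_const (f := fun s => (Γ.splitEdge e t).voltage
        (splitPoint e t p) ((Γ.splitEdge e t).path (splitNewEdge e t) s) (splitPoint e t q)),
        ← splitPoint_path_right hs.1.le, hV]
  · refine Finset.sum_congr rfl fun f hf => ?_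
    have hf := Finset.ne_of_mem_erase hf
    rw [len_splitOldEdge_of_ne hf]
    simp only [← splitPoint_path_of_ne hf, hV]

end Invariance

/-! ### Reduction of the identification of arbitrary points to that of vertices. -/

section Subdivide

variable {Γ : MetrizedGraph.{u, v}}

theorem subdividePoint_self (p : Γ.Point) :
    Γ.subdividePoint p p = .vertex (Γ.subdivideNew p) := by
  cases p with
  | vertex a => rfl
  | inner e t => exact splitPoint_inner

theorem subdividePoint_vertex (p : Γ.Point) (a : Γ.V) :
    Γ.subdividePoint p (.vertex a) = .vertex (Γ.subdivideOld p a) := by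
  cases p <;> rfl

theorem Rigid.subdivide (hΓ : Γ.Rigid) (p : Γ.Point) : (Γ.subdivide p).Rigid := by
  cases p with
  | vertex a => exact hΓ
  | inner e t => exact hΓ.splitEdge e t

theorem Rigid.tau_subdivide (hΓ : Γ.Rigid) (p : Γ.Point) : (Γ.subdivide p).tau = Γ.tau := by
  cases p with
  | vertex a => rfl
  | inner e t => exact hΓ.tau_splitEdge e t

theorem Rigid.resistance_subdividePoint (hΓ : Γ.Rigid) (p x y : Γ.Point) :
    (Γ.subdivide p).resistance (Γ.subdividePoint p x) (Γ.subdividePoint p y) =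
      Γ.resistance x y := by
  cases p with
  | vertex a => rfl
  | inner e t => exact hΓ.voltage_splitPoint x y y

theorem Rigid.A_subdividePoint (hΓ : Γ.Rigid) (p x y : Γ.Point) :
    (Γ.subdivide p).A (Γ.subdividePoint p x) (Γ.subdividePoint p y) = Γ.A x y := by
  cases p with
  | vertex a => rfl
  | inner e t => exact hΓ.A_splitPoint x y

theorem Rigid.tau_identify (hΓ : Γ.Rigid) (p q : Γ.Point) :
    (Γ.identify p q).tau =
      Γ.tau - Γ.resistance p q / 6 + Γ.A p q / Γ.resistance p q := by
  have h₁ := hΓ.subdivide p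
  have h₂ := h₁.subdivide (Γ.subdividePoint p q)
  rw [identify, h₂.tau_identifyVertices, h₁.tau_subdivide, hΓ.tau_subdivide,
    ← subdividePoint_vertex, ← subdividePoint_self, ← subdividePoint_self,
    h₁.resistance_subdividePoint, hΓ.resistance_subdividePoint, h₁.A_subdividePoint,
    hΓ.A_subdividePoint]

end Subdivide

end

end MetrizedGraph

theorem mainTheorem12 (Γ : MetrizedGraph.{u, v}) (hΓ : Γ.Connected) :
    (∀ e : Γ.E, (Γ.deleteEdge e).Connected →
      ∀ (L R A : ℝ), L = Γ.len e →
        R = (Γ.deleteEdge e).resistance (.vertex (Γ.src e)) (.vertex (Γ.tgt e)) →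
        A = (Γ.deleteEdge e).A (.vertex (Γ.src e)) (.vertex (Γ.tgt e)) →
        Γ.tau = (Γ.contractEdge e).tau + L / 12 - L * A / (R * (L + R)) ∧
        Γ.tau = (Γ.identifyEnds e).tau - L * A / (R * (L + R))) ∧
    (∀ p q : Γ.Point, p ≠ q →
      (Γ.identify p q).tau =
        Γ.tau - Γ.resistance p q / 6 + Γ.A p q / Γ.resistance p q) := by
  refine ⟨fun e he L R A hL hR hA => ?_, fun p q _ => hΓ.rigid.tau_identify p q⟩
  have h := he.rigid.tau_eq_contractEdge_add hL hR hA
  refine ⟨h, ?_⟩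
  rw [h, he.rigid.tau_identifyEnds, hL]
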